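/- **Setting.** For each sample size $n$ let $X=(X_{\rm obs},X_{\rm mis})$ have a strictly positive density $f(\cdot\mid\psi)$ (depending on $n$), $\psi\in\Psi\subseteq\mathbb R^h$ with $\Psi$ open, and write $L(\psi\mid X)=\log f(X\mid\psi)$. Let $\theta:\Psi\to\mathbb R^k$ ($k\ge1$) be the parameter function of interest, $\psi^\star\in\Psi$ the true parameter, $\theta^\star=\theta(\psi^\star)$, and consider $H_0:\theta^\star=\theta_0$. Given $X_{\rm obs}$ (drawn from the model at $\psi^\star$), let $X^1_{\rm mis},\dots,X^m_{\rm mis}$ be drawn conditionally independently from an imputation model $K_n(\cdot\mid X_{\rm obs})$, let $X^\ell=(X_{\rm obs},X^\ell_{\rm mis})$, $L^\ell(\psi)=L(\psi\mid X^\ell)$ and $\overline L=m^{-1}\sum_{\ell=1}^m L^\ell$. Let $\widehat\psi(X)$, $\widehat\psi_0(X)$ be the maximizers of $L(\cdot\mid X)$ over $\Psi$ and over $\Psi_0=\{\psi\in\Psi:\theta(\psi)=\theta_0\}$; let $\widehat\psi^*,\widehat\psi_0^*$ be those of $\overline L$; let $\widehat\psi_{\rm obs}$ be the maximizer over $\Psi$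 of the observed-data likelihood (the density of $X_{\rm obs}$). All are measurable, and are arbitrary elements of the constraint set for data for which no maximizer exists. Put $\widehat\psi^\ell=\widehat\psi(X^\ell)$, $\widehat\psi_0^\ell=\widehat\psi_0(X^\ell)$, $\widehat\theta^\ell=\theta(\widehat\psi^\ell)$, $\widehat\theta_{\rm obs}=\theta(\widehat\psi_{\rm obs})$ and $$\overline d=\frac1m\sum_{\ell=1}^m 2\log\frac{f(X^\ell\mid\widehat\psi^\ell)}{f(X^\ell\mid\widehat\psi^\ell_0)},\qquad \widehat d=2\{\overline L(\widehat\psi^*)-\overline L(\widehat\psi_0^*)\},$$ $$\widehat r=\frac{m+1}{k(m-1)}(\overline d-\widehat d),\qquad \widehat r^+=\max(0,\widehat r),\qquad \widehat D^+=\frac{\widehat d}{k(1+\widehat r^+)} .$$ **Regularity conditions $\mathrm{RC}_\theta$.** 1. $L(\cdot\mid X)$ is $C^2$ on $\Psi$, $\theta$ is $C^1$ on $\Psi$, and its Jacobian $G$ at $\psi^\star$ has rank $k$. 2. There is a positive definite matrix $\mathcal I$ such that, both for the complete data $X\sim f(\cdot\mid\psi^\star)$ and for a completed data set $X=X^\ell$,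 as $n\to\infty$: (i) $\nabla L(\psi^\star\mid X)=O_p(\sqrt n)$; (ii) for every $\varepsilon>0$ there is $\delta>0$ such that, with probability tending to one, every entry of $-n^{-1}\nabla^2L(\psi\mid X)-\mathcal I$ is at most $\varepsilon$ in absolute value for all $\psi\in\Psi$ with $|\psi-\psi^\star|\le\delta$; (iii) for every $\varepsilon>0$, with probability tending to one, $L(\psi\mid X)<L(\psi^\star\mid X)$ for all $\psi\in\Psi$ with $|\psi-\psi^\star|\ge\varepsilon$. 3. Let $\mathcal U_\theta=n^{-1}G\mathcal I^{-1}G^{\mathsf T}$. For some $r\ge0$, $\mathcal T_\theta=(1+r)\,\mathcal U_\theta$ (equal fraction of missing information), and $\mathcal T_\theta^{-1/2}(\widehat\theta_{\rm obs}-\theta^\star)\Rightarrow N_k(0,I_k)$. 4. The imputation is proper: with $\mathcal B_\theta=\mathcal T_\theta-\mathcal U_\theta$, assumed invertible (that is, $r>0$), the conditional law of $\mathcal B_\theta^{-1/2}(\widehat\theta^\ell-\widehat\theta_{\rm obs})$ given $X_{\rm obs}$ converges weakly, in probability, to $N_k(0,I_k)$. **Lemma.** Let $m>1$ be fixed, assume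 $\mathrm{RC}_\theta$ with $r>0$, and put $r_m=(1+1/m)r$. Under $H_0$, as $n\to\infty$, jointly, $$\Bigl(\frac{\widehat r^{+}}{r_m},\ \widehat D^{+}\Bigr)\Rightarrow\Bigl(M_2,\ \frac{(1+r_m)M_1}{1+r_mM_2}\Bigr),$$ where $M_1\sim\chi^2_k/k$ and $M_2\sim\chi^2_{k(m-1)}/\{k(m-1)\}$ are independent. -/

import Mathlib

open MeasureTheory ProbabilityTheory Filter Topology
open scoped ENNReal BoundedContinuousFunction MatrixOrder

namespace MILRT

noncomputable section

/-- A parametric model, for each sample size `n`, of a complete data set `x = (y, z)` with observed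
part `y : 𝒴 n` and missing part `z : 𝒵 n`. The dominating measure is `obsBase n ⊗ₘ misBase n`;
`misBase n` is a kernel since which entries are missing (a record that belongs to `y`) may vary.
An ignorable missing-data mechanism contributes a factor free of `ψ` and of `z` to the density and
is thus part of `obsBase`. The densities have common support, taken to be the whole space. -/
structure SamplingModel (h : ℕ) (𝒴 𝒵 : ℕ → Type*) [∀ n, MeasurableSpace (𝒴 n)]
    [∀ n, MeasurableSpace (𝒵 n)] where
  /-- the parameter space -/
  Ψ : Set (EuclideanSpace ℝ (Fin h))
  isOpen_Ψ : IsOpen Ψ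
  obsBase : ∀ n, Measure (𝒴 n)
  sFinite_obsBase : ∀ n, SFinite (obsBase n)
  misBase : ∀ n, Kernel (𝒴 n) (𝒵 n)
  sFinite_misBase : ∀ n, IsSFiniteKernel (misBase n)
  /-- `f n ψ x` is the density `f(x ∣ ψ)` of the complete data of size `n` -/
  f : ∀ n, EuclideanSpace ℝ (Fin h) → 𝒴 n × 𝒵 n → ℝ
  measurable_f : ∀ n, ∀ ψ ∈ Ψ, Measurable (f n ψ)
  f_pos : ∀ n, ∀ ψ ∈ Ψ, ∀ x, 0 < f n ψ x
  lintegral_f : ∀ n, ∀ ψ ∈ Ψ,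
    ∫⁻ x, ENNReal.ofReal (f n ψ x) ∂(obsBase n ⊗ₘ misBase n) = 1

section Model

variable {h k m : ℕ} {𝒴 𝒵 : ℕ → Type*} [∀ n, MeasurableSpace (𝒴 n)] [∀ n, MeasurableSpace (𝒵 n)]

/-- The law of the complete data under `ψ`. -/
def SamplingModel.law (M : SamplingModel h 𝒴 𝒵) (n : ℕ) (ψ : EuclideanSpace ℝ (Fin h)) :
    Measure (𝒴 n × 𝒵 n) :=
  (M.obsBase n ⊗ₘ M.misBase n).withDensity fun x => ENNReal.ofReal (M.f n ψ x)

/-- The law of the observed data under `ψ`. -/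
def SamplingModel.obsLaw (M : SamplingModel h 𝒴 𝒵) (n : ℕ) (ψ : EuclideanSpace ℝ (Fin h)) :
    Measure (𝒴 n) :=
  (M.law n ψ).map Prod.fst

/-- The complete-data log-likelihood `log f(x ∣ ψ)`. -/
def SamplingModel.logLik (M : SamplingModel h 𝒴 𝒵) (n : ℕ) (x : 𝒴 n × 𝒵 n)
    (ψ : EuclideanSpace ℝ (Fin h)) : ℝ :=
  Real.log (M.f n ψ x)

/-- The average log-likelihood of `m` completed data sets. -/
def SamplingModel.avgLogLik (M : SamplingModel h 𝒴 𝒵) (n : ℕ) (x : Fin m → 𝒴 n × 𝒵 n)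
    (ψ : EuclideanSpace ℝ (Fin h)) : ℝ :=
  (1 / (m : ℝ)) * ∑ l, M.logLik n (x l) ψ

/-- The observed-data likelihood: the missing part is integrated out. -/
def SamplingModel.obsLik (M : SamplingModel h 𝒴 𝒵) (n : ℕ) (y : 𝒴 n)
    (ψ : EuclideanSpace ℝ (Fin h)) : ℝ≥0∞ :=
  ∫⁻ z, ENNReal.ofReal (M.f n ψ (y, z)) ∂(M.misBase n y)

/-- The normalized observed information matrix `- n⁻¹ ∂² log f(x ∣ ψ) / ∂ψ ∂ψᵀ`. -/
def SamplingModel.info (M : SamplingModel h 𝒴 𝒵) (n : ℕ) (x : 𝒴 n × 𝒵 n)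
    (ψ : EuclideanSpace ℝ (Fin h)) : Matrix (Fin h) (Fin h) ℝ :=
  Matrix.of fun i j => -((n : ℝ)⁻¹ * iteratedFDeriv ℝ 2 (M.logLik n x) ψ
    ![EuclideanSpace.single i 1, EuclideanSpace.single j 1])

/-- `T d` is, for every data set `d`, a maximizer of the criterion `L d` over `C` if there is one
(and some element of `C` otherwise), and depends measurably on `d`. -/
structure IsArgmaxEstimator {D E R : Type*} [MeasurableSpace D] [MeasurableSpace E] [Preorder R]
    (C : Set E) (L : D → E → R) (T : D → E) : Prop where
  measurable : Measurable T
  mem : ∀ d, T d ∈ C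
  isMaxOn : ∀ d, (∃ p ∈ C, IsMaxOn (L d) C p) → IsMaxOn (L d) C (T d)

/-- The parameter values allowed by the null hypothesis `θ(ψ) = θ₀`. -/
def SamplingModel.nullSet (M : SamplingModel h 𝒴 𝒵)
    (θ : EuclideanSpace ℝ (Fin h) → EuclideanSpace ℝ (Fin k)) (θ₀ : EuclideanSpace ℝ (Fin k)) :
    Set (EuclideanSpace ℝ (Fin h)) :=
  {ψ ∈ M.Ψ | θ ψ = θ₀}

/-- The maximum likelihood estimators used in the likelihood ratio test for multiply imputed data:
from one complete data set (`full`, and `null` under the null hypothesis), and from the averaged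
log-likelihood of `m` completed data sets (`fullAvg`, `nullAvg`). -/
structure Estimators (h m : ℕ) (𝒴 𝒵 : ℕ → Type*) where
  full : ∀ n, 𝒴 n × 𝒵 n → EuclideanSpace ℝ (Fin h)
  null : ∀ n, 𝒴 n × 𝒵 n → EuclideanSpace ℝ (Fin h)
  fullAvg : ∀ n, (Fin m → 𝒴 n × 𝒵 n) → EuclideanSpace ℝ (Fin h)
  nullAvg : ∀ n, (Fin m → 𝒴 n × 𝒵 n) → EuclideanSpace ℝ (Fin h)

/-- The estimators are what their names say. -/
structure Estimators.AreMLE (T : Estimators h m 𝒴 𝒵) (M : SamplingModel h 𝒴 𝒵)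
    (θ : EuclideanSpace ℝ (Fin h) → EuclideanSpace ℝ (Fin k))
    (θ₀ : EuclideanSpace ℝ (Fin k)) : Prop where
  full : ∀ n, IsArgmaxEstimator M.Ψ (M.logLik n) (T.full n)
  null : ∀ n, IsArgmaxEstimator (M.nullSet θ θ₀) (M.logLik n) (T.null n)
  fullAvg : ∀ n, IsArgmaxEstimator M.Ψ (M.avgLogLik (m := m) n) (T.fullAvg n)
  nullAvg : ∀ n, IsArgmaxEstimator (M.nullSet θ θ₀) (M.avgLogLik (m := m) n) (T.nullAvg n)

/-! ### The test statistics -/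

/-- The likelihood ratio function `2 log (f(x ∣ ψ) / f(x ∣ ψ₀))`. -/
def SamplingModel.dL (M : SamplingModel h 𝒴 𝒵) (n : ℕ) (ψ₀ ψ : EuclideanSpace ℝ (Fin h))
    (x : 𝒴 n × 𝒵 n) : ℝ :=
  2 * Real.log (M.f n ψ x / M.f n ψ₀ x)

/-- Average of the likelihood ratio statistics of the `m` completed data sets. -/
def dBar (M : SamplingModel h 𝒴 𝒵) (T : Estimators h m 𝒴 𝒵) (n : ℕ)
    (x : Fin m → 𝒴 n × 𝒵 n) : ℝ :=
  (1 / (m : ℝ)) * ∑ l, M.dL n (T.null n (x l)) (T.full n (x l)) (x l)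

/-- Likelihood ratio statistic of the averaged log-likelihood. -/
def dHat (M : SamplingModel h 𝒴 𝒵) (T : Estimators h m 𝒴 𝒵) (n : ℕ)
    (x : Fin m → 𝒴 n × 𝒵 n) : ℝ :=
  2 * (M.avgLogLik n x (T.fullAvg n x) - M.avgLogLik n x (T.nullAvg n x))

/-- The estimator of `r_m`; here `k` is the dimension of `θ`. -/
def rHat (k : ℕ) (M : SamplingModel h 𝒴 𝒵) (T : Estimators h m 𝒴 𝒵) (n : ℕ)
    (x : Fin m → 𝒴 n × 𝒵 n) : ℝ :=
  ((m : ℝ) + 1) / ((k : ℝ) * ((m : ℝ) - 1)) * (dBar M T n x - dHat M T n x)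

/-- The positive part of `rHat`. -/
def rHatPlus (k : ℕ) (M : SamplingModel h 𝒴 𝒵) (T : Estimators h m 𝒴 𝒵) (n : ℕ)
    (x : Fin m → 𝒴 n × 𝒵 n) : ℝ :=
  max 0 (rHat k M T n x)

/-- The combining rule for a given value `ρ` of `r_m`. -/
def DHat (k : ℕ) (M : SamplingModel h 𝒴 𝒵) (T : Estimators h m 𝒴 𝒵) (n : ℕ)
    (x : Fin m → 𝒴 n × 𝒵 n) (ρ : ℝ) : ℝ :=
  dHat M T n x / ((k : ℝ) * (1 + ρ))

/-- The test statistic obtained by plugging in `rHatPlus`. -/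
def DHatPlus (k : ℕ) (M : SamplingModel h 𝒴 𝒵) (T : Estimators h m 𝒴 𝒵) (n : ℕ)
    (x : Fin m → 𝒴 n × 𝒵 n) : ℝ :=
  DHat k M T n x (rHatPlus k M T n x)

/-! ### Multiple imputation -/

/-- On the probability spaces `(Ω n, P n)`, `Y n` is observed data from the model with true
parameter `ψs`, and, given `Y n`, the missing parts `Z n 0, …, Z n (m-1)` are imputed
conditionally independently from the imputation model `K n`. -/
structure IsMultipleImputation (M : SamplingModel h 𝒴 𝒵) (ψs : EuclideanSpace ℝ (Fin h))
    (K : ∀ n, Kernel (𝒴 n) (𝒵 n)) {Ω : ℕ → Type*} [∀ n, MeasurableSpace (Ω n)]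
    (P : ∀ n, Measure (Ω n)) (Y : ∀ n, Ω n → 𝒴 n) (Z : ∀ n, Fin m → Ω n → 𝒵 n) : Prop where
  measurable_obs : ∀ n, Measurable (Y n)
  measurable_mis : ∀ n l, Measurable (Z n l)
  obs_law : ∀ n, (P n).map (Y n) = M.obsLaw n ψs
  cond_indep : ∀ n, ∀ A : Set (𝒴 n), MeasurableSet A → ∀ B : Fin m → Set (𝒵 n),
    (∀ l, MeasurableSet (B l)) →
      P n {ω | Y n ω ∈ A ∧ ∀ l, Z n l ω ∈ B l} =
        ∫⁻ y in A, ∏ l, K n y (B l) ∂(M.obsLaw n ψs)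

/-- The `m` completed data sets. -/
def completed {Ω : ℕ → Type*} (Y : ∀ n, Ω n → 𝒴 n) (Z : ∀ n, Fin m → Ω n → 𝒵 n) (n : ℕ)
    (ω : Ω n) : Fin m → 𝒴 n × 𝒵 n :=
  fun l => (Y n ω, Z n l ω)

/-! ### Regularity conditions -/

/-- Classical regularity, at `ψs`, of the likelihood of complete-data sets with laws `Q n`. -/
structure LikelihoodRegular (M : SamplingModel h 𝒴 𝒵) (ψs : EuclideanSpace ℝ (Fin h))
    (I : Matrix (Fin h) (Fin h) ℝ) (Q : ∀ n, Measure (𝒴 n × 𝒵 n)) : Prop where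
  /-- the score at `ψs` is `O_p(√n)` -/
  score : ∀ ε : ℝ≥0∞, 0 < ε → ∃ c : ℝ, ∀ᶠ n : ℕ in atTop,
    Q n {x | c * √(n : ℝ) < ‖gradient (M.logLik n x) ψs‖} ≤ ε
  /-- the normalized observed information converges in probability to `I`, locally uniformly -/
  info : ∀ ε : ℝ, 0 < ε → ∃ δ : ℝ, 0 < δ ∧ Tendsto (fun n => Q n {x | ∃ ψ ∈ M.Ψ,
    ‖ψ - ψs‖ ≤ δ ∧ ∃ i j, ε < |M.info n x ψ i j - I i j|}) atTop (𝓝 0)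
  /-- away from `ψs` the likelihood is below its value at `ψs`, with probability tending to one -/
  separated : ∀ ε : ℝ, 0 < ε → Tendsto (fun n => Q n {x | ∃ ψ ∈ M.Ψ,
    ε ≤ ‖ψ - ψs‖ ∧ M.logLik n x ψs ≤ M.logLik n x ψ}) atTop (𝓝 0)

/-- The Jacobian matrix of `θ` at `ψ`. -/
def jacobian (θ : EuclideanSpace ℝ (Fin h) → EuclideanSpace ℝ (Fin k))
    (ψ : EuclideanSpace ℝ (Fin h)) : Matrix (Fin k) (Fin h) ℝ :=
  Matrix.of fun i j => (fderiv ℝ θ ψ (EuclideanSpace.single j 1)) i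

/-- The asymptotic variance `𝒰_θ` of the complete-data MLE of `θ(ψ)` from `n` observations with
unit information `I`. -/
def Uθ (θ : EuclideanSpace ℝ (Fin h) → EuclideanSpace ℝ (Fin k)) (ψ : EuclideanSpace ℝ (Fin h))
    (I : Matrix (Fin h) (Fin h) ℝ) (n : ℕ) : Matrix (Fin k) (Fin k) ℝ :=
  (n : ℝ)⁻¹ • (jacobian θ ψ * I⁻¹ * (jacobian θ ψ).transpose)

/-- `A^{-1/2} v` for a positive definite matrix `A`. -/
def invSqrtMul (A : Matrix (Fin k) (Fin k) ℝ) (v : EuclideanSpace ℝ (Fin k)) :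
    EuclideanSpace ℝ (Fin k) :=
  Matrix.toEuclideanLin (CFC.sqrt A⁻¹) v

/-- The regularity conditions: `ψs` is the true parameter, `K` the imputation model, `I` the unit
information matrix, `𝒯 n` the asymptotic variance of the observed-data MLE of `θ`, and `r` the odds
of missing information; `full` and `obs` are the complete-data and observed-data MLEs of `ψ`. -/
structure RCθ (M : SamplingModel h 𝒴 𝒵)
    (θ : EuclideanSpace ℝ (Fin h) → EuclideanSpace ℝ (Fin k)) (ψs : EuclideanSpace ℝ (Fin h))
    (K : ∀ n, Kernel (𝒴 n) (𝒵 n)) (full : ∀ n, 𝒴 n × 𝒵 n → EuclideanSpace ℝ (Fin h))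
    (obs : ∀ n, 𝒴 n → EuclideanSpace ℝ (Fin h)) (I : Matrix (Fin h) (Fin h) ℝ)
    (𝒯 : ℕ → Matrix (Fin k) (Fin k) ℝ) (r : ℝ) : Prop where
  mem_Ψ : ψs ∈ M.Ψ
  smooth_θ : ContDiffOn ℝ 1 θ M.Ψ
  full_rank : Function.Surjective (fderiv ℝ θ ψs)
  smooth_logLik : ∀ n x, ContDiffOn ℝ 2 (M.logLik n x) M.Ψ
  posDef_I : I.PosDef
  /-- the likelihood is regular for the complete data -/
  regular_complete : LikelihoodRegular M ψs I (fun n => M.law n ψs)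
  /-- the likelihood is regular for a completed data set -/
  regular_completed : LikelihoodRegular M ψs I (fun n => M.obsLaw n ψs ⊗ₘ K n)
  /-- equal fraction of missing information -/
  efmi : ∀ n, 𝒯 n = (1 + r) • Uθ θ ψs I n
  /-- `𝒯_θ^{-1/2} (θ̂_obs - θ(ψs))` converges in distribution to the standard normal law -/
  obs_normal : ∀ g : EuclideanSpace ℝ (Fin k) →ᵇ ℝ,
    Tendsto (fun n => ∫ y, g (invSqrtMul (𝒯 n) (θ (obs n y) - θ ψs)) ∂(M.obsLaw n ψs)) atTop
      (𝓝 (∫ w, g w ∂(stdGaussian (EuclideanSpace ℝ (Fin k)))))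
  /-- proper imputation: given the observed data, `ℬ_θ^{-1/2} (θ̂^ℓ - θ̂_obs)` with
  `ℬ_θ = 𝒯_θ - 𝒰_θ` converges in distribution, in probability, to the standard normal law -/
  proper : ∀ g : EuclideanSpace ℝ (Fin k) →ᵇ ℝ, ∀ ε : ℝ, 0 < ε →
    Tendsto (fun n => M.obsLaw n ψs {y |
      ε ≤ |∫ z, g (invSqrtMul (𝒯 n - Uθ θ ψs I n) (θ (full n (y, z)) - θ (obs n y))) ∂(K n y) -
        ∫ w, g w ∂(stdGaussian (EuclideanSpace ℝ (Fin k)))|}) atTop (𝓝 0)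

end Model

/-- The chi-squared distribution with `d` degrees of freedom: the law of the sum of the squares of
`d` independent standard normal variables. -/
def chiSq (d : ℕ) : Measure ℝ :=
  (Measure.pi fun _ : Fin d => gaussianReal 0 1).map fun x => ∑ i, x i ^ 2

/-- The law `χ²_d / d`. -/
def chiSqDiv (d : ℕ) : Measure ℝ :=
  (chiSq d).map fun x => x / (d : ℝ)

end

end MILRT

/-! Each likelihood ratio statistic is asymptotically a squared norm, and all the norms involved
come from one Gaussian vector. Put `v = √n (ψ - ψs)`. With probability tending to one the
log-likelihood increment is uniformly close to `⟪A w, v⟫ - ⟪v, A v⟫ / 2`, where `A` is the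
information `I` and `√n A w` is the score. With `G` the Jacobian and `D = (G I⁻¹ Gᵀ)^{-1/2} G`, the
constrained and unconstrained maxima of this quadratic differ by `‖D w‖² / 2`, and `√n (G I⁻¹
Gᵀ)^{-1/2} (θ̂ - θ*)` is close to `D w` (`exists_lrt_approx`).

The regularity is inherited by the averaged log-likelihood, and `w` is linear in the score. Hence,
if `W l` is the standardized estimate from completed data set `l`, the statistic `d̄` is close to
the mean of the `‖W l‖²` and `d̂` to the squared norm of the mean of the same `W l`
(`exists_dBar_dHat_approx`). So `d̄ - d̂` measures the dispersion of the `W l`.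

Equal fraction of missing information makes all covariance matrices multiples of `G I⁻¹ Gᵀ`, so that
`W l = √(1 + r) X₀ + √r X_l` exactly, with `X₀` the standardized observed-data estimate and `X_l`
the standardized imputation deviation (`stdEst_eq_combined`). These variables are jointly
asymptotically independent standard normal: given the observed data, the imputation deviations have
a limit law that does not depend on the data (`tendstoInDistribution_imputations`).

In the limit the mean of the `W l` has covariance `1 + r + r / m = 1 + r_m` times the identity. The
deviations involve only the `X_l` and are independent of the mean, which gives the two chi-squared
variables (`map_stdGaussian_combined`). Slutsky's theorem and continuity of the statistics in `(d̄,
d̂)` finish the proof. -/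

namespace MILRT

/-! ### Taylor expansion and entrywise bounds for quadratic forms -/

section Analysis

open scoped RealInnerProductSpace

/-- Second order Taylor expansion along a segment, with the second derivative close to `-q`. -/
lemma abs_taylor_remainder_le {E : Type*} [NormedAddCommGroup E] [InnerProductSpace ℝ E]
    [CompleteSpace E] {L : E → ℝ} {Ψ : Set E} (hΨ : IsOpen Ψ) (hL : ContDiffOn ℝ 2 L Ψ) {x u : E}
    {q c : ℝ} (hseg : ∀ t ∈ Set.Icc (0 : ℝ) 1, x + t • u ∈ Ψ)
    (hc : ∀ t ∈ Set.Icc (0 : ℝ) 1, |iteratedFDeriv ℝ 2 L (x + t • u) ![u, u] + q| ≤ c) :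
    |L (x + u) - L x - ⟪gradient L x, u⟫ + q / 2| ≤ c := by
  have hat : ∀ y ∈ Ψ, ContDiffAt ℝ 2 L y := fun y hy => hL.contDiffAt (hΨ.mem_nhds hy)
  have hγ : ∀ t : ℝ, HasDerivAt (fun t : ℝ => x + t • u) u t := fun t => by
    simpa using ((hasDerivAt_id t).smul_const u).const_add x
  have hd1 : ∀ t ∈ Set.Icc (0 : ℝ) 1, HasDerivAt (fun t : ℝ => L (x + t • u))
      (fderiv ℝ L (x + t • u) u) t := fun t ht =>
    (((hat _ (hseg t ht)).differentiableAt (by norm_num)).hasFDerivAt).comp_hasDerivAt t (hγ t)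
  have hd2 : ∀ t ∈ Set.Icc (0 : ℝ) 1, HasDerivAt (fun t : ℝ => fderiv ℝ L (x + t • u) u)
      (iteratedFDeriv ℝ 2 L (x + t • u) ![u, u]) t := fun t ht => by
    have h1 : DifferentiableAt ℝ (fderiv ℝ L) (x + t • u) :=
      ((hat _ (hseg t ht)).fderiv_right (m := 1) (by norm_num)).differentiableAt (by norm_num)
    rw [iteratedFDeriv_two_apply]
    have h2 := h1.hasFDerivAt.comp_hasDerivAt t (hγ t)
    simpa using h2.clm_apply (hasDerivAt_const t u)
  obtain ⟨d, hd⟩ : ∃ d, d = fderiv ℝ L x u := ⟨_, rfl⟩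
  have hg : ⟪gradient L x, u⟫ = d := by
    simp [gradient, hd]
  -- The mean value inequality is used twice, here for the first derivative and below for `L`
  -- itself. Bounding `t` by one each time costs a harmless factor 2 in the remainder.
  have b1 : ∀ t ∈ Set.Icc (0 : ℝ) 1, ‖fderiv ℝ L (x + t • u) u - d + q * t‖ ≤ c := by
    intro t ht
    have := norm_image_sub_le_of_norm_deriv_le_segment' (a := (0 : ℝ)) (b := 1) (C := c)
      (f := fun t : ℝ => fderiv ℝ L (x + t • u) u + q * t)
      (f' := fun t => iteratedFDeriv ℝ 2 L (x + t • u) ![u, u] + q)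
      (fun s hs => ((hd2 s hs).add (by simpa using (hasDerivAt_id s).const_mul q)).hasDerivWithinAt)
      (fun s hs => hc s ⟨hs.1, hs.2.le⟩) t ht
    have hc0 : 0 ≤ c := (abs_nonneg _).trans (hc 0 (by simp))
    simp only [zero_smul, add_zero, mul_zero, sub_zero] at this
    rw [← hd, add_sub_right_comm] at this
    exact this.trans (mul_le_of_le_one_right hc0 ht.2)
  have := norm_image_sub_le_of_norm_deriv_le_segment_01' (C := c)
      (f := fun t : ℝ => L (x + t • u) - d * t + q * t ^ 2 / 2)
      (f' := fun t => fderiv ℝ L (x + t • u) u - d + q * t)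
      (fun s hs => by
        have h2 : HasDerivAt (fun t : ℝ => q * t ^ 2 / 2) (q * s) s := by
          have := ((hasDerivAt_pow 2 s).const_mul q).div_const 2
          exact this.congr_deriv (by norm_num; ring)
        have h3 : HasDerivAt (fun t : ℝ => d * t) (d) s := by
          simpa using (hasDerivAt_id s).const_mul (d)
        exact (((hd1 s hs).sub h3).add h2).hasDerivWithinAt)
      (fun s hs => b1 s ⟨hs.1, hs.2.le⟩)
  rw [hg]
  convert this using 2
  rw [Real.norm_eq_abs, one_smul, zero_smul, add_zero]
  congr 1
  generalize L (x + u) = a, L x = b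
  ring

/-- Cauchy–Schwarz for `∑ |u i|` produces the factor `h`. This is the cost of passing from the
entrywise control of the Hessian in the regularity conditions to control of the quadratic form. -/
lemma abs_sum_sum_mul_le {h : ℕ} (M : Fin h → Fin h → ℝ) (u : EuclideanSpace ℝ (Fin h)) {c : ℝ}
    (hM : ∀ i j, |M i j| ≤ c) (hc : 0 ≤ c) :
    |∑ i, ∑ j, u i * u j * M i j| ≤ c * h * ‖u‖ ^ 2 := by
  calc |∑ i, ∑ j, u i * u j * M i j| ≤ ∑ i, ∑ j, |u i| * |u j| * c := by
        refine (Finset.abs_sum_le_sum_abs _ _).trans (Finset.sum_le_sum fun i _ => ?_)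
        refine (Finset.abs_sum_le_sum_abs _ _).trans (Finset.sum_le_sum fun j _ => ?_)
        rw [abs_mul, abs_mul]
        exact mul_le_mul_of_nonneg_left (hM i j) (by positivity)
    _ = c * (∑ i, |u i|) ^ 2 := by
        rw [sq, Finset.sum_mul_sum, Finset.mul_sum]
        refine Finset.sum_congr rfl fun i _ => ?_
        rw [Finset.mul_sum]
        exact Finset.sum_congr rfl fun j _ => by ring
    _ ≤ c * (h * ‖u‖ ^ 2) := by
        gcongr
        have := sq_sum_le_card_mul_sum_sq (s := Finset.univ) (f := fun i => |u i|)
        simpa [EuclideanSpace.real_norm_sq_eq] using this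
    _ = c * h * ‖u‖ ^ 2 := by ring

lemma bilin_apply_eq_sum {h : ℕ} (b : EuclideanSpace ℝ (Fin h) →L[ℝ] EuclideanSpace ℝ (Fin h) →L[ℝ] ℝ)
    (u : EuclideanSpace ℝ (Fin h)) :
    b u u = ∑ i, ∑ j, u i * u j *
      b (EuclideanSpace.single i 1) (EuclideanSpace.single j 1) := by
  conv_lhs => rw [← (EuclideanSpace.basisFun (Fin h) ℝ).sum_repr u]
  simp only [map_sum, sum_apply, map_smul, smul_apply,
    EuclideanSpace.basisFun_apply, EuclideanSpace.basisFun_repr, smul_eq_mul, Finset.mul_sum]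
  rw [Finset.sum_comm]
  exact Finset.sum_congr rfl fun i _ => Finset.sum_congr rfl fun j _ => by ring

end Analysis

/-! ### Maximizing a function close to a concave quadratic -/

section Quadratic

open scoped RealInnerProductSpace

variable {E F F' : Type*} [NormedAddCommGroup E] [InnerProductSpace ℝ E]
  [NormedAddCommGroup F] [InnerProductSpace ℝ F] [NormedAddCommGroup F'] [InnerProductSpace ℝ F']

/-- The linear algebra of a likelihood ratio test: `A` is the information, `G` the derivative of the
parameter of interest, `P` the `A`-orthogonal projection onto the kernel of `G`, and `‖D v‖²` the
`A`-norm of `v - P v`. -/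
structure InfoGeometry (A : E →L[ℝ] E) (G : E →L[ℝ] F) (D : E →L[ℝ] F') (B : F →L[ℝ] F')
    (P : E →L[ℝ] E) (lam : ℝ) : Prop where
  symm : ∀ x y, ⟪A x, y⟫ = ⟪x, A y⟫
  lam_pos : 0 < lam
  coercive : ∀ v, lam * ‖v‖ ^ 2 ≤ ⟪v, A v⟫
  norm_D_sq_le : ∀ v, ‖D v‖ ^ 2 ≤ ⟪v, A v⟫
  D_eq : ∀ v, D v = B (G v)
  G_proj : ∀ v, G (P v) = 0
  inner_sub_proj : ∀ v, ⟪v - P v, A (v - P v)⟫ = ‖D v‖ ^ 2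

variable {A : E →L[ℝ] E} {G : E →L[ℝ] F} {D : E →L[ℝ] F'} {B : F →L[ℝ] F'} {P : E →L[ℝ] E}
  {lam : ℝ} {Λ : E → ℝ} {w : E} {τ ρ C R : ℝ}

/-- Nonnegativity gives `0 ≤ ‖A‖ C ‖v‖ - (lam / 2) ‖v‖² + (lam / 4) ‖v‖²`. For maximizers this
improves consistency, `‖v‖ ≤ ρ`, to a bound independent of the sample size. -/
lemma InfoGeometry.norm_le_of_nonneg (H : InfoGeometry A G D B P lam)
    (hΛ : ∀ v, ‖v‖ ≤ ρ → |Λ v - (⟪A w, v⟫ - ⟪v, A v⟫ / 2)| ≤ τ * ‖v‖ ^ 2)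
    (hτ : τ ≤ lam / 4) (hw : ‖w‖ ≤ C) {v : E} (hv : ‖v‖ ≤ ρ) (h0 : 0 ≤ Λ v) :
    ‖v‖ ≤ 4 * ‖A‖ * C / lam := by
  have h1 := (abs_le.1 (hΛ v hv)).2
  have h2 := H.coercive v
  have h3 : ⟪A w, v⟫ ≤ ‖A‖ * C * ‖v‖ :=
    (real_inner_le_norm _ _).trans (mul_le_mul_of_nonneg_right
      ((A.le_opNorm w).trans (mul_le_mul_of_nonneg_left hw (norm_nonneg _))) (norm_nonneg _))
  have h4 : τ * ‖v‖ ^ 2 ≤ lam / 4 * ‖v‖ ^ 2 := mul_le_mul_of_nonneg_right hτ (sq_nonneg _)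
  have hl := H.lam_pos
  rw [le_div_iff₀ hl]
  rcases (norm_nonneg v).eq_or_lt with h | h
  · rw [← h]
    have : 0 ≤ C := (norm_nonneg w).trans hw
    nlinarith [mul_nonneg (norm_nonneg A) this]
  · refine le_of_mul_le_mul_right ?_ h
    nlinarith

/-- Completing the square: `2 ⟪A w, v⟫ - ⟪v, A v⟫ = ⟪w, A w⟫ - ⟪v - w, A (v - w)⟫`. -/
lemma InfoGeometry.two_mul_sub_le (H : InfoGeometry A G D B P lam)
    (hΛ : ∀ v, ‖v‖ ≤ ρ → |Λ v - (⟪A w, v⟫ - ⟪v, A v⟫ / 2)| ≤ τ * ‖v‖ ^ 2)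
    (hτ : 0 ≤ τ) (hR : R ≤ ρ) {v : E} (hv : ‖v‖ ≤ R) :
    |2 * Λ v - (⟪w, A w⟫ - ⟪v - w, A (v - w)⟫)| ≤ 2 * τ * R ^ 2 := by
  have h1 := abs_le.1 (hΛ v (hv.trans hR))
  have h2 : τ * ‖v‖ ^ 2 ≤ τ * R ^ 2 := by gcongr
  have h3 : ⟪v - w, A (v - w)⟫ = ⟪v, A v⟫ - 2 * ⟪A w, v⟫ + ⟪w, A w⟫ := by
    rw [map_sub, inner_sub_left, inner_sub_right, inner_sub_right, ← H.symm w v,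
      real_inner_comm (A w) v]
    ring
  rw [h3, abs_le]
  constructor <;> linarith [h1.1, h1.2]

/-- The quadratic peaks at `w`, so a point that does at least as well as `w` up to the approximation
error must, by coercivity, lie near `w`. -/
lemma InfoGeometry.norm_sub_sq_le (H : InfoGeometry A G D B P lam)
    (hΛ : ∀ v, ‖v‖ ≤ ρ → |Λ v - (⟪A w, v⟫ - ⟪v, A v⟫ / 2)| ≤ τ * ‖v‖ ^ 2)
    (hτ : 0 ≤ τ) (hR : R ≤ ρ) (hw : ‖w‖ ≤ R) {v : E} (hv : ‖v‖ ≤ R) (hle : Λ w ≤ Λ v) :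
    lam * ‖v - w‖ ^ 2 ≤ 4 * τ * R ^ 2 := by
  have h1 := abs_le.1 (H.two_mul_sub_le hΛ hτ hR hv)
  have h2 := abs_le.1 (H.two_mul_sub_le hΛ hτ hR hw)
  have h3 := H.coercive (v - w)
  simp only [sub_self, map_zero, inner_zero_left, sub_zero] at h2
  linarith [h1.1, h1.2, h2.1, h2.2]

/-- Here `v` and `v₀` play the unconstrained and constrained maximizers, and `v'` a feasible
competitor close to the projection `P w`. After completing the square, twice the difference is the
`A`-distance squared from `v₀` to `w`, up to errors. Almost-feasibility `G v₀ ≈ 0` bounds it below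
by `‖D w‖²`, and comparison with `v'` bounds it above. -/
lemma InfoGeometry.abs_two_mul_sub_le (H : InfoGeometry A G D B P lam)
    (hΛ : ∀ v, ‖v‖ ≤ ρ → |Λ v - (⟪A w, v⟫ - ⟪v, A v⟫ / 2)| ≤ τ * ‖v‖ ^ 2)
    (hτ : 0 ≤ τ) (hτ1 : τ ≤ 1) (hR : R ≤ ρ) (hw : ‖w‖ ≤ R) {v v₀ v' : E} (hv : ‖v‖ ≤ R)
    (hv₀ : ‖v₀‖ ≤ R) (hv' : ‖v'‖ ≤ R) (hP : ‖P w‖ ≤ R) (hle : Λ w ≤ Λ v) (hle' : Λ v' ≤ Λ v₀)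
    (hG : ‖G v₀‖ ≤ τ * R) (hPv' : ‖v' - P w‖ ≤ τ * R) :
    |2 * (Λ v - Λ v₀) - ‖D w‖ ^ 2| ≤ τ * ((4 + 2 * ‖D‖ * ‖B‖ + 5 * ‖A‖) * R ^ 2) := by
  have hR0 : 0 ≤ R := (norm_nonneg w).trans hw
  have b1 := abs_le.1 (H.two_mul_sub_le hΛ hτ hR hv)
  have b2 := abs_le.1 (H.two_mul_sub_le hΛ hτ hR hw)
  have b3 := abs_le.1 (H.two_mul_sub_le hΛ hτ hR hv₀)
  have b4 := abs_le.1 (H.two_mul_sub_le hΛ hτ hR hv')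
  have p1 : 0 ≤ ⟪v - w, A (v - w)⟫ := (by have := H.lam_pos; positivity : 0 ≤ lam * ‖v - w‖ ^ 2).trans
    (H.coercive _)
  simp only [sub_self, map_zero, inner_zero_left, sub_zero] at b2
  -- Since `D` factors through `G`, `D v₀` is small, so `D (v₀ - w)` is nearly `-D w`.
  have c1 : ‖D w‖ ^ 2 - τ * (2 * ‖D‖ * ‖B‖ * R ^ 2) ≤ ⟪v₀ - w, A (v₀ - w)⟫ := by
    refine le_trans ?_ (H.norm_D_sq_le _)
    have d1 : ‖D v₀‖ ≤ ‖B‖ * (τ * R) := by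
      rw [H.D_eq]
      exact (B.le_opNorm _).trans (mul_le_mul_of_nonneg_left hG (norm_nonneg _))
    have d2 : ‖D w‖ ≤ ‖D‖ * R :=
      (D.le_opNorm _).trans (mul_le_mul_of_nonneg_left hw (norm_nonneg _))
    have d3 : ‖D w‖ * ‖D v₀‖ ≤ (‖D‖ * R) * (‖B‖ * (τ * R)) := by gcongr
    have d4 : ‖D (v₀ - w)‖ ^ 2 = ‖D v₀‖ ^ 2 - 2 * ⟪D v₀, D w⟫ + ‖D w‖ ^ 2 := by
      rw [map_sub, norm_sub_sq_real]
    have d5 := real_inner_le_norm (D v₀) (D w)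
    rw [d4]
    nlinarith [sq_nonneg ‖D v₀‖]
  -- Expand around `P w`: of the constant 5, the cross term contributes 4 and the square of `v' - P
  -- w` contributes 1, by `τ ≤ 1`.
  have c2 : ⟪v' - w, A (v' - w)⟫ ≤ ‖D w‖ ^ 2 + τ * (5 * ‖A‖ * R ^ 2) := by
    have e0 : v' - w = (v' - P w) - (w - P w) := by abel
    have e1 : ⟪v' - w, A (v' - w)⟫ = ⟪v' - P w, A (v' - P w)⟫
        - 2 * ⟪A (v' - P w), w - P w⟫ + ‖D w‖ ^ 2 := by
      rw [e0, ← H.inner_sub_proj w]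
      generalize v' - P w = x
      generalize w - P w = y
      rw [map_sub, inner_sub_left, inner_sub_right, inner_sub_right, ← H.symm x y,
        real_inner_comm (A x) y]
      ring
    have e2 : ‖A (v' - P w)‖ ≤ ‖A‖ * (τ * R) :=
      (A.le_opNorm _).trans (mul_le_mul_of_nonneg_left hPv' (norm_nonneg _))
    have e3 : ‖w - P w‖ ≤ 2 * R := (norm_sub_le _ _).trans (by linarith)
    have e4 : |⟪A (v' - P w), w - P w⟫| ≤ (‖A‖ * (τ * R)) * (2 * R) :=
      (abs_real_inner_le_norm _ _).trans (by gcongr)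
    have e5 : ⟪v' - P w, A (v' - P w)⟫ ≤ (τ * R) * (‖A‖ * (τ * R)) :=
      (real_inner_le_norm _ _).trans (by gcongr)
    have e6 : (τ * R) * (‖A‖ * (τ * R)) ≤ (τ * R) * (‖A‖ * (1 * R)) := by gcongr
    rw [e1]
    linarith [(abs_le.1 e4).1]
  rw [abs_le]
  constructor
  · have : 0 ≤ τ * (5 * ‖A‖ * R ^ 2) := by positivity
    linarith [b1.1, b1.2, b2.1, b2.2, b3.1, b3.2, b4.1, b4.2]
  · have : 0 ≤ τ * (2 * ‖D‖ * ‖B‖ * R ^ 2) := by positivity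
    linarith [b1.1, b1.2, b2.1, b2.2, b3.1, b3.2, b4.1, b4.2]

end Quadratic

/-! ### Likelihood ratio and estimator on the regular event -/

section Deterministic

open scoped RealInnerProductSpace

/-- The implicit function theorem parametrizes the level set of `θ` over the kernel of `G`, with
derivative at 0 the inclusion, so the displacement from the tangent space is `o(‖v‖)`. This supplies
a feasible competitor for the constrained maximum when the null hypothesis is a curved surface. -/
lemma exists_level_set_point {E F : Type*} [NormedAddCommGroup E] [NormedSpace ℝ E]
    [CompleteSpace E] [NormedAddCommGroup F] [NormedSpace ℝ F] [FiniteDimensional ℝ F]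
    {θ : E → F} {G : E →L[ℝ] F} {a : E} (hθ : HasStrictFDerivAt θ G a)
    (hG : Function.Surjective G) {t : ℝ} (ht : 0 < t) :
    ∃ δ > 0, ∀ v, G v = 0 → ‖v‖ ≤ δ → ∃ x, θ x = θ a ∧ ‖x - a - v‖ ≤ t * ‖v‖ := by
  have hG' : G.range = ⊤ := LinearMap.range_eq_top.2 hG
  have h1 := (hθ.to_implicitFunction hG').hasFDerivAt.isLittleO
  have h2 := h1.bound ht
  have h3 : ∀ᶠ v : G.ker in 𝓝 0, θ (hθ.implicitFunction θ G hG' (θ a) v) = θ a := by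
    have : Tendsto (fun v : G.ker => (θ a, v)) (𝓝 0) (𝓝 (θ a, 0)) := by
      exact (Continuous.prodMk_right (θ a)).tendsto 0
    exact this.eventually (hθ.map_implicitFunction_eq hG')
  obtain ⟨δ, hδ, hball⟩ := Metric.nhds_basis_closedBall.mem_iff.1 (h2.and h3)
  refine ⟨δ, hδ, fun v hv hvδ => ?_⟩
  have := @hball ⟨v, hv⟩ (by simpa using hvδ)
  obtain ⟨p1, p2⟩ := this
  refine ⟨_, p2, ?_⟩
  simpa using p1

/-- The event on which the likelihood of a data set behaves regularly. -/
structure GoodLik {h : ℕ} (Ψ : Set (EuclideanSpace ℝ (Fin h))) (ψs : EuclideanSpace ℝ (Fin h))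
    (I : Matrix (Fin h) (Fin h) ℝ) (n : ℕ) (C δ τ ρ : ℝ) (L : EuclideanSpace ℝ (Fin h) → ℝ) :
    Prop where
  smooth : ContDiffOn ℝ 2 L Ψ
  score : ‖gradient L ψs‖ ≤ C * √(n : ℝ)
  info : ∀ ψ ∈ Ψ, ‖ψ - ψs‖ ≤ δ → ∀ i j, |-((n : ℝ)⁻¹ * iteratedFDeriv ℝ 2 L ψ
    ![EuclideanSpace.single i 1, EuclideanSpace.single j 1]) - I i j| ≤ τ
  separated : ∀ ψ ∈ Ψ, ρ ≤ ‖ψ - ψs‖ → L ψ < L ψs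

variable {h : ℕ} {Ψ : Set (EuclideanSpace ℝ (Fin h))} {ψs : EuclideanSpace ℝ (Fin h)}
  {I : Matrix (Fin h) (Fin h) ℝ} {n : ℕ} {C δ τ ρ : ℝ} {L : EuclideanSpace ℝ (Fin h) → ℝ}

lemma gradient_const_mul_sum {m : ℕ} {L : Fin m → EuclideanSpace ℝ (Fin h) → ℝ} (c : ℝ)
    {x : EuclideanSpace ℝ (Fin h)} (hL : ∀ l, DifferentiableAt ℝ (L l) x) :
    gradient (fun ψ => c * ∑ l, L l ψ) x = c • ∑ l, gradient (L l) x := by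
  have h1 : HasFDerivAt (fun ψ => c * ∑ l, L l ψ) (c • ∑ l, fderiv ℝ (L l) x) x :=
    (HasFDerivAt.fun_sum fun l _ => (hL l).hasFDerivAt).const_mul c
  simp [gradient, h1.fderiv]

/-- Every condition is stable under averaging, with the same constants. Hence the analysis of one
data set applies verbatim to the averaged log-likelihood, that is, to `d̂`. -/
lemma GoodLik.average (hΨ : IsOpen Ψ) (hψs : ψs ∈ Ψ) {m : ℕ} (hm : 0 < m)
    {L : Fin m → EuclideanSpace ℝ (Fin h) → ℝ} (hL : ∀ l, GoodLik Ψ ψs I n C δ τ ρ (L l)) :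
    GoodLik Ψ ψs I n C δ τ ρ (fun ψ => (1 / (m : ℝ)) * ∑ l, L l ψ) := by
  have hm' : (0 : ℝ) < m := by exact_mod_cast hm
  have hcard : ∀ c : ℝ, (1 / (m : ℝ)) * ∑ _l : Fin m, c = c := fun c => by
    simp only [Finset.sum_const, Finset.card_univ, Fintype.card_fin, nsmul_eq_mul]
    field_simp
  refine ⟨contDiffOn_const.mul (ContDiffOn.sum fun l _ => (hL l).smooth), ?_, ?_, ?_⟩
  · rw [gradient_const_mul_sum _ fun l =>
      ((hL l).smooth.contDiffAt (hΨ.mem_nhds hψs)).differentiableAt (by norm_num)]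
    rw [norm_smul, Real.norm_of_nonneg (by positivity), ← hcard (C * √(n : ℝ))]
    exact mul_le_mul_of_nonneg_left ((norm_sum_le _ _).trans
      (Finset.sum_le_sum fun l _ => (hL l).score)) (by positivity)
  · intro ψ hψ hd i j
    have hat : ∀ l, ContDiffAt ℝ 2 (L l) ψ := fun l => (hL l).smooth.contDiffAt (hΨ.mem_nhds hψ)
    have e : iteratedFDeriv ℝ 2 (fun ψ => (1 / (m : ℝ)) * ∑ l, L l ψ) ψ
        = (1 / (m : ℝ)) • ∑ l, iteratedFDeriv ℝ 2 (L l) ψ := by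
      have := iteratedFDeriv_const_smul_apply' (i := 2) (a := (1 / (m : ℝ)))
        (f := fun ψ => ∑ l, L l ψ) (x := ψ) (ContDiffAt.sum fun l _ => hat l)
      simp only [smul_eq_mul] at this
      rw [this, iteratedFDeriv_fun_sum_apply fun l _ => hat l]
    have e2 : -((n : ℝ)⁻¹ * iteratedFDeriv ℝ 2 (fun ψ => (1 / (m : ℝ)) * ∑ l, L l ψ) ψ
        ![EuclideanSpace.single i 1, EuclideanSpace.single j 1]) - I i j
        = (1 / (m : ℝ)) * ∑ l, (-((n : ℝ)⁻¹ * iteratedFDeriv ℝ 2 (L l) ψ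
        ![EuclideanSpace.single i 1, EuclideanSpace.single j 1]) - I i j) := by
      rw [e, Finset.sum_sub_distrib, mul_sub, hcard]
      simp only [smul_apply, sum_apply,
        smul_eq_mul, Finset.sum_neg_distrib, ← Finset.mul_sum]
      ring
    rw [e2, abs_mul, abs_of_pos (by positivity : 0 < 1 / (m : ℝ)), ← hcard τ]
    exact mul_le_mul_of_nonneg_left ((Finset.abs_sum_le_sum_abs _ _).trans
      (Finset.sum_le_sum fun l _ => (hL l).info ψ hψ hd i j)) (by positivity)
  · intro ψ hψ hd
    have : Nonempty (Fin m) := ⟨⟨0, hm⟩⟩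
    exact mul_lt_mul_of_pos_left (Finset.sum_lt_sum_of_nonempty Finset.univ_nonempty
      fun l _ => (hL l).separated ψ hψ hd) (by positivity)

/-- With `u = v / √n`, the score `√n A w` paired with `u` is `⟪A w, v⟫`, and a Hessian close to `-n
I` evaluated at `u` is close to `-⟪v, A v⟫`. -/
lemma GoodLik.quadratic (hL : GoodLik Ψ ψs I n C δ τ ρ L) (hΨ : IsOpen Ψ) (hn : 0 < n)
    {δ' : ℝ} (hδ : δ' ≤ δ) (hball : Metric.closedBall ψs δ' ⊆ Ψ) (hτ : 0 ≤ τ)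
    {A : EuclideanSpace ℝ (Fin h) →L[ℝ] EuclideanSpace ℝ (Fin h)}
    (hA : ∀ v, ⟪v, A v⟫ = ∑ i, ∑ j, v i * v j * I i j) {w : EuclideanSpace ℝ (Fin h)}
    (hw : √(n : ℝ) • A w = gradient L ψs) {v : EuclideanSpace ℝ (Fin h)}
    (hv : ‖v‖ ≤ δ' * √(n : ℝ)) :
    |(L (ψs + (√(n : ℝ))⁻¹ • v) - L ψs) - (⟪A w, v⟫ - ⟪v, A v⟫ / 2)| ≤ τ * h * ‖v‖ ^ 2 := by
  have hn' : (0 : ℝ) < n := by exact_mod_cast hn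
  have hs : 0 < √(n : ℝ) := Real.sqrt_pos.2 hn'
  set u := (√(n : ℝ))⁻¹ • v with hu
  have hun : ‖u‖ ≤ δ' := by
    rw [hu, norm_smul, Real.norm_of_nonneg (by positivity), inv_mul_le_iff₀ hs, mul_comm]
    exact hv
  have hmem : ∀ t ∈ Set.Icc (0 : ℝ) 1, ‖ψs + t • u - ψs‖ ≤ δ' := fun t ht => by
    rw [add_sub_cancel_left, norm_smul, Real.norm_of_nonneg ht.1]
    exact (mul_le_of_le_one_left (norm_nonneg _) ht.2).trans hun
  have hΨmem : ∀ t ∈ Set.Icc (0 : ℝ) 1, ψs + t • u ∈ Ψ := fun t ht =>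
    hball (by rw [Metric.mem_closedBall, dist_eq_norm]; exact hmem t ht)
  have huv : ∀ i, (u i : ℝ) = (√(n : ℝ))⁻¹ * v i := fun i => by simp [hu]
  have hss : (√(n : ℝ))⁻¹ * (√(n : ℝ))⁻¹ = (n : ℝ)⁻¹ := by
    rw [← mul_inv, Real.mul_self_sqrt hn'.le]
  have key := abs_taylor_remainder_le (q := ⟪v, A v⟫) (c := τ * h * ‖v‖ ^ 2) hΨ hL.smooth hΨmem
    (fun t ht => by
      have e1 : iteratedFDeriv ℝ 2 L (ψs + t • u) ![u, u] + ⟪v, A v⟫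
          = -∑ i, ∑ j, v i * v j * (-((n : ℝ)⁻¹ * iteratedFDeriv ℝ 2 L (ψs + t • u)
            ![EuclideanSpace.single i 1, EuclideanSpace.single j 1]) - I i j) := by
        have := bilin_apply_eq_sum (fderiv ℝ (fderiv ℝ L) (ψs + t • u)) u
        simp only [iteratedFDeriv_two_apply, Matrix.cons_val_zero, Matrix.cons_val_one, hA]
        rw [this, ← Finset.sum_neg_distrib, ← Finset.sum_add_distrib]
        refine Finset.sum_congr rfl fun i _ => ?_
        rw [← Finset.sum_neg_distrib, ← Finset.sum_add_distrib]
        refine Finset.sum_congr rfl fun j _ => ?_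
        rw [huv, huv, ← hss]
        ring
      rw [e1, abs_neg]
      exact abs_sum_sum_mul_le _ v (fun i j => hL.info _ (hΨmem t ht) ((hmem t ht).trans hδ) i j) hτ)
  have e2 : ⟪gradient L ψs, u⟫ = ⟪A w, v⟫ := by
    rw [← hw, hu, real_inner_smul_left, real_inner_smul_right]
    field_simp
  rw [e2] at key
  convert key using 2
  ring

/-- If the likelihood is separated at radius `ρ`, a constrained maximizer exists. -/
lemma GoodLik.exists_isMaxOn (hL : GoodLik Ψ ψs I n C δ τ ρ L)
    (hρ : 0 ≤ ρ) {S : Set (EuclideanSpace ℝ (Fin h))}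
    (hS : S ⊆ Ψ) (hψs : ψs ∈ S) (hclosed : IsClosed (S ∩ Metric.closedBall ψs ρ)) :
    ∃ p ∈ S, IsMaxOn L S p := by
  have hcomp : IsCompact (S ∩ Metric.closedBall ψs ρ) :=
    (isCompact_closedBall ψs ρ).of_isClosed_subset hclosed Set.inter_subset_right
  obtain ⟨p, hp, hmax⟩ := hcomp.exists_isMaxOn ⟨ψs, hψs, Metric.mem_closedBall_self hρ⟩
    (hL.smooth.continuousOn.mono (Set.inter_subset_left.trans hS))
  refine ⟨p, hp.1, fun x hx => ?_⟩
  by_cases hxb : x ∈ Metric.closedBall ψs ρ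
  · exact hmax ⟨hx, hxb⟩
  · have h1 : L ψs ≤ L p := hmax ⟨hψs, Metric.mem_closedBall_self hρ⟩
    have h2 := hL.separated x (hS hx) (by
      rw [Metric.mem_closedBall, dist_eq_norm, not_le] at hxb; exact hxb.le)
    exact h2.le.trans h1

/-- The likelihood ratio statistic and the maximum likelihood estimator are, on the regular event,
close to their Gaussian approximations; `w` is the rescaled solution of the score equation. -/
theorem exists_lrt_approx {F F' : Type*} [NormedAddCommGroup F] [InnerProductSpace ℝ F]
    [FiniteDimensional ℝ F] [NormedAddCommGroup F'] [InnerProductSpace ℝ F']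
    {A P : EuclideanSpace ℝ (Fin h) →L[ℝ] EuclideanSpace ℝ (Fin h)}
    {G : EuclideanSpace ℝ (Fin h) →L[ℝ] F} {D : EuclideanSpace ℝ (Fin h) →L[ℝ] F'}
    {B : F →L[ℝ] F'} {lam : ℝ} (H : InfoGeometry A G D B P lam)
    (hA : ∀ v, ⟪v, A v⟫ = ∑ i, ∑ j, v i * v j * I i j)
    (hΨ : IsOpen Ψ) (hψs : ψs ∈ Ψ) {θ : EuclideanSpace ℝ (Fin h) → F} (hθc : ContinuousOn θ Ψ)
    (hθ : HasStrictFDerivAt θ G ψs) (hG : Function.Surjective G) {η : ℝ} (hC : 0 ≤ C) (hη : 0 < η) :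
    ∃ τ > 0, ∀ δ > 0, ∃ ρ > 0, ∃ N : ℕ, ∀ n ≥ N, ∀ L, GoodLik Ψ ψs I n C δ τ ρ L →
      ∀ w, √(n : ℝ) • A w = gradient L ψs → ∀ ψ ∈ Ψ, ((∃ p ∈ Ψ, IsMaxOn L Ψ p) → IsMaxOn L Ψ ψ) →
      ∀ ψ₀ ∈ {ψ ∈ Ψ | θ ψ = θ ψs}, ((∃ p ∈ {ψ ∈ Ψ | θ ψ = θ ψs},
        IsMaxOn L {ψ ∈ Ψ | θ ψ = θ ψs} p) → IsMaxOn L {ψ ∈ Ψ | θ ψ = θ ψs} ψ₀) →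
      |2 * (L ψ - L ψ₀) - ‖D w‖ ^ 2| ≤ η ∧ ‖√(n : ℝ) • B (θ ψ - θ ψs) - D w‖ ≤ η ∧
        ‖D w‖ ≤ ‖D‖ * (C / lam) := by
  have hlam := H.lam_pos
  set C' := C / lam with hC'
  have hC'0 : 0 ≤ C' := by positivity
  -- One radius for all five points: the first term bounds the rescaled maximizers, `C'` bounds `w`,
  -- and `2 ‖P‖ C'` bounds `P w` and the competitor near it.
  set R := 4 * ‖A‖ * C' / lam + (1 + 2 * ‖P‖) * C' with hRdef
  have hR0 : 0 ≤ R := by positivity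
  have hR1 : 4 * ‖A‖ * C' / lam ≤ R := le_add_of_nonneg_right (by positivity)
  have hR2 : (1 + 2 * ‖P‖) * C' ≤ R := le_add_of_nonneg_left (by positivity)
  have hR3 : C' ≤ R := by
    have : 0 ≤ 2 * ‖P‖ * C' := by positivity
    linarith
  have hR4 : 2 * ‖P‖ * C' ≤ R := by linarith
  set K := (4 + 2 * ‖D‖ * ‖B‖ + 5 * ‖A‖) * R ^ 2 with hK
  -- The tolerance `t` serves the comparison of maxima (`t ≤ 1`), the localization (`t ≤ lam / 4`),
  -- and the final errors of the likelihood ratio statistic and of the estimator.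
  obtain ⟨t, ht0, ht1, htl, htK, htB⟩ : ∃ t > 0, t ≤ 1 ∧ t ≤ lam / 4 ∧ t * K ≤ η ∧
      ‖B‖ * (t * R) + ‖D‖ * √(4 * t * R ^ 2 / lam) ≤ η := by
    have e1 : Tendsto (fun t : ℝ => t * K) (𝓝[>] 0) (𝓝 0) :=
      tendsto_nhdsWithin_of_tendsto_nhds (by
        have : Continuous fun t : ℝ => t * K := by fun_prop
        simpa using this.tendsto 0)
    have e2 : Tendsto (fun t : ℝ => ‖B‖ * (t * R) + ‖D‖ * √(4 * t * R ^ 2 / lam)) (𝓝[>] 0) (𝓝 0) :=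
      tendsto_nhdsWithin_of_tendsto_nhds (by
        have : Continuous fun t : ℝ => ‖B‖ * (t * R) + ‖D‖ * √(4 * t * R ^ 2 / lam) := by fun_prop
        simpa using this.tendsto 0)
    have e3 : ∀ c > (0 : ℝ), ∀ᶠ t in 𝓝[>] (0 : ℝ), t ≤ c := fun c hc =>
      nhdsWithin_le_nhds (Iic_mem_nhds hc)
    obtain ⟨t, h1, h2, h3, h4, h5⟩ := ((e1.eventually_le_const hη).and ((e2.eventually_le_const hη).and
      ((e3 1 one_pos).and ((e3 (lam / 4) (by positivity)).and self_mem_nhdsWithin)))).exists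
    exact ⟨t, h5, h3, h4, h1, h2⟩
  -- The quadratic approximation loses a factor `h`; dividing by `h + 1` also covers `h = 0`.
  refine ⟨t / (h + 1), by positivity, fun δ hδ => ?_⟩
  obtain ⟨δ₁, hδ₁, hball₁⟩ := Metric.nhds_basis_closedBall.mem_iff.1 (hΨ.mem_nhds hψs)
  obtain ⟨δ₂, hδ₂, hball₂⟩ := Metric.nhds_basis_closedBall.mem_iff.1
    (hθ.hasFDerivAt.isLittleO.bound ht0)
  obtain ⟨δ₃, hδ₃, hlevel⟩ := exists_level_set_point hθ hG ht0
  -- Within `ρ` the Hessian bound holds, the ball stays in `Ψ`, `θ` is linear up to `t`, and the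
  -- level set is parametrized.
  set ρ := min δ (min δ₁ (min δ₂ δ₃)) with hρ
  have hρ0 : 0 < ρ := by positivity
  have hρδ : ρ ≤ δ := min_le_left _ _
  have hρ1 : ρ ≤ δ₁ := (min_le_right _ _).trans (min_le_left _ _)
  have hρ2 : ρ ≤ δ₂ := (min_le_right _ _).trans ((min_le_right _ _).trans (min_le_left _ _))
  have hρ3 : ρ ≤ δ₃ := (min_le_right _ _).trans ((min_le_right _ _).trans (min_le_right _ _))
  have hballρ : Metric.closedBall ψs ρ ⊆ Ψ := (Metric.closedBall_subset_closedBall hρ1).trans hball₁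
  have hsqrt : Tendsto (fun n : ℕ => ρ * √(n : ℝ)) atTop atTop :=
    (Real.tendsto_sqrt_atTop.comp tendsto_natCast_atTop_atTop).const_mul_atTop hρ0
  -- Once `R ≤ ρ √n`, every rescaled point of norm at most `R` lies where the quadratic
  -- approximation is valid.
  obtain ⟨N, hN⟩ := eventually_atTop.1 ((hsqrt.eventually_ge_atTop R).and (eventually_gt_atTop 0))
  refine ⟨ρ, hρ0, N, fun n hn L hL w hw ψ hψ hψmax ψ₀ hψ₀ hψ₀max => ?_⟩
  obtain ⟨hRn, hn0⟩ := hN n hn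
  have hn' : (0 : ℝ) < n := by exact_mod_cast hn0
  have hs : 0 < √(n : ℝ) := Real.sqrt_pos.2 hn'
  -- the solution of the score equation is bounded
  have hwC : ‖w‖ ≤ C' := by
    have h1 : ‖A w‖ ≤ C := by
      have : √(n : ℝ) * ‖A w‖ ≤ √(n : ℝ) * C := by
        rw [mul_comm (√(n : ℝ)) C]
        refine le_trans (le_of_eq ?_) hL.score
        rw [← hw, norm_smul, Real.norm_of_nonneg hs.le]
      exact le_of_mul_le_mul_left this hs
    have h2 := (H.coercive w).trans ((real_inner_le_norm _ _).trans
      (mul_le_mul_of_nonneg_left h1 (norm_nonneg w)))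
    rw [hC', le_div_iff₀ hlam]
    rcases (norm_nonneg w).eq_or_lt with h0 | h0
    · rw [← h0]; simpa using hC
    · refine le_of_mul_le_mul_left ?_ h0
      linarith
  -- the local quadratic approximation
  set Λ : EuclideanSpace ℝ (Fin h) → ℝ := fun v => L (ψs + (√(n : ℝ))⁻¹ • v) - L ψs with hΛdef
  have hΛ : ∀ v, ‖v‖ ≤ ρ * √(n : ℝ) →
      |Λ v - (⟪A w, v⟫ - ⟪v, A v⟫ / 2)| ≤ t * ‖v‖ ^ 2 := fun v hv => by
    refine (hL.quadratic hΨ hn0 hρδ hballρ (by positivity) hA hw hv).trans ?_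
    gcongr
    rw [div_mul_eq_mul_div, div_le_iff₀ (by positivity)]
    nlinarith
  have hΛψ : ∀ ψ, Λ (√(n : ℝ) • (ψ - ψs)) = L ψ - L ψs := fun ψ => by
    simp only [hΛdef, smul_smul, inv_mul_cancel₀ hs.ne', one_smul, add_sub_cancel]
  have hscale : ∀ ψ, ‖ψ - ψs‖ ≤ ρ → ‖√(n : ℝ) • (ψ - ψs)‖ ≤ ρ * √(n : ℝ) := fun ψ hψ => by
    rw [norm_smul, Real.norm_of_nonneg hs.le, mul_comm]
    gcongr
  have hθapprox : ∀ ψ, ‖ψ - ψs‖ ≤ ρ → ‖√(n : ℝ) • (θ ψ - θ ψs) - G (√(n : ℝ) • (ψ - ψs))‖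
      ≤ t * ‖√(n : ℝ) • (ψ - ψs)‖ := fun ψ hψ => by
    have : ‖θ ψ - θ ψs - G (ψ - ψs)‖ ≤ t * ‖ψ - ψs‖ :=
      hball₂ (Metric.closedBall_subset_closedBall hρ2 (by
        rwa [Metric.mem_closedBall, dist_eq_norm]))
    rw [map_smul, ← smul_sub, norm_smul, norm_smul, Real.norm_of_nonneg hs.le, mul_left_comm]
    gcongr
  -- maximizers exist
  have hmaxψ : IsMaxOn L Ψ ψ := hψmax (hL.exists_isMaxOn hρ0.le subset_rfl hψs (by
    rw [Set.inter_eq_right.2 hballρ]; exact Metric.isClosed_closedBall))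
  have hψsS : ψs ∈ {ψ ∈ Ψ | θ ψ = θ ψs} := ⟨hψs, rfl⟩
  have hmaxψ₀ : IsMaxOn L {ψ ∈ Ψ | θ ψ = θ ψs} ψ₀ := by
    refine hψ₀max (hL.exists_isMaxOn hρ0.le (fun x hx => hx.1) hψsS ?_)
    -- The null set need not be closed, as `Ψ` is open; its part in a closed ball contained in `Ψ`
    -- is.
    have e : {ψ ∈ Ψ | θ ψ = θ ψs} ∩ Metric.closedBall ψs ρ
        = Metric.closedBall ψs ρ ∩ θ ⁻¹' {θ ψs} := by
      ext x
      exact ⟨fun hx => ⟨hx.2, hx.1.2⟩, fun hx => ⟨⟨hballρ hx.1, hx.2⟩, hx.1⟩⟩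
    rw [e]
    exact (hθc.mono hballρ).preimage_isClosed_of_isClosed Metric.isClosed_closedBall
      isClosed_singleton
  have hnear : ∀ ψ ∈ Ψ, L ψs ≤ L ψ → ‖ψ - ψs‖ ≤ ρ := fun ψ hψ hle => by
    by_contra hcon
    exact absurd (hL.separated ψ hψ (not_le.1 hcon).le) (not_lt.2 hle)
  have hψge : L ψs ≤ L ψ := hmaxψ hψs
  have hψ₀ge : L ψs ≤ L ψ₀ := hmaxψ₀ hψsS
  have hψρ := hnear ψ hψ hψge
  have hψ₀ρ := hnear ψ₀ hψ₀.1 hψ₀ge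
  set v := √(n : ℝ) • (ψ - ψs) with hv
  set v₀ := √(n : ℝ) • (ψ₀ - ψs) with hv₀
  have hvR : ‖v‖ ≤ R := (H.norm_le_of_nonneg hΛ htl hwC (hscale ψ hψρ)
    (by rw [hΛψ]; linarith)).trans hR1
  have hv₀R : ‖v₀‖ ≤ R := (H.norm_le_of_nonneg hΛ htl hwC (hscale ψ₀ hψ₀ρ)
    (by rw [hΛψ]; linarith)).trans hR1
  have hwR : ‖w‖ ≤ R := hwC.trans hR3
  -- comparison points
  have hmemΨ : ∀ v, ‖v‖ ≤ R → ψs + (√(n : ℝ))⁻¹ • v ∈ Ψ := fun v hv => hballρ (by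
    rw [Metric.mem_closedBall, dist_eq_norm, add_sub_cancel_left, norm_smul,
      Real.norm_of_nonneg (by positivity), inv_mul_le_iff₀ hs, mul_comm]
    exact hv.trans hRn)
  have hle : Λ w ≤ Λ v := by
    rw [hΛψ]
    exact sub_le_sub_right (hmaxψ (hmemΨ w hwR)) _
  have hPw : ‖P w‖ ≤ ‖P‖ * C' := (P.le_opNorm w).trans (by gcongr)
  have hPwR : ‖P w‖ ≤ R := by
    have : 0 ≤ ‖P‖ * C' := by positivity
    linarith
  obtain ⟨x, hx, hxn⟩ := hlevel ((√(n : ℝ))⁻¹ • P w) (by rw [map_smul, H.G_proj, smul_zero]) (by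
    rw [norm_smul, Real.norm_of_nonneg (by positivity), inv_mul_le_iff₀ hs, mul_comm]
    exact hPwR.trans (hRn.trans (by gcongr)))
  set v' := √(n : ℝ) • (x - ψs) with hv'
  have hxv' : x = ψs + (√(n : ℝ))⁻¹ • v' := by
    rw [hv', smul_smul, inv_mul_cancel₀ hs.ne', one_smul, add_sub_cancel]
  have hPv' : ‖v' - P w‖ ≤ t * ‖P w‖ := by
    have e : v' - P w = √(n : ℝ) • (x - ψs - (√(n : ℝ))⁻¹ • P w) := by
      rw [smul_sub, smul_smul, mul_inv_cancel₀ hs.ne', one_smul]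
    rw [e, norm_smul, Real.norm_of_nonneg hs.le]
    refine (mul_le_mul_of_nonneg_left hxn hs.le).trans (le_of_eq ?_)
    rw [norm_smul, Real.norm_of_nonneg (by positivity)]
    field_simp
  have hv'R : ‖v'‖ ≤ R := by
    have h1 : ‖v'‖ ≤ ‖v' - P w‖ + ‖P w‖ := norm_le_norm_sub_add v' (P w)
    have h2 : t * ‖P w‖ ≤ 1 * ‖P w‖ := by gcongr
    linarith
  have hle' : Λ v' ≤ Λ v₀ := by
    rw [hΛψ, hΛψ]
    refine sub_le_sub_right (hmaxψ₀ (show x ∈ {ψ ∈ Ψ | θ ψ = θ ψs} from ⟨?_, hx⟩)) _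
    rw [hxv']
    exact hmemΨ v' hv'R
  have hGv₀ : ‖G v₀‖ ≤ t * R := by
    have := hθapprox ψ₀ hψ₀ρ
    rw [hψ₀.2, sub_self, smul_zero, zero_sub, norm_neg] at this
    exact this.trans (by gcongr)
  refine ⟨?_, ?_, (D.le_opNorm w).trans (by gcongr)⟩
  · have := H.abs_two_mul_sub_le hΛ ht0.le ht1 hRn hwR hvR hv₀R hv'R hPwR hle hle' hGv₀
      (hPv'.trans (by gcongr))
    rw [hΛψ, hΛψ] at this
    rw [show L ψ - L ψ₀ = L ψ - L ψs - (L ψ₀ - L ψs) by ring]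
    exact this.trans htK
  · have h1 := H.norm_sub_sq_le hΛ ht0.le hRn hwR hvR hle
    have h2 : ‖v - w‖ ≤ √(4 * t * R ^ 2 / lam) := by
      apply Real.le_sqrt_of_sq_le
      rw [le_div_iff₀ hlam]
      linarith
    -- Two errors: the nonlinearity of `θ`, and the distance from the rescaled maximizer to `w`.
    have e : √(n : ℝ) • B (θ ψ - θ ψs) - D w
        = B (√(n : ℝ) • (θ ψ - θ ψs) - G v) + D (v - w) := by
      simp only [map_sub, ← H.D_eq, map_smul, smul_sub]
      abel
    rw [e]
    refine (norm_add_le _ _).trans (le_trans (add_le_add ?_ ?_) htB)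
    · exact (B.le_opNorm _).trans (mul_le_mul_of_nonneg_left
        ((hθapprox ψ hψρ).trans (by gcongr)) (norm_nonneg _))
    · exact (D.le_opNorm _).trans (by gcongr)

end Deterministic

/-! ### Inverse square roots and the projection for the information inner product -/

section MatrixGeometry

open scoped RealInnerProductSpace
open Matrix

variable {h k : ℕ}

/-- `A^{-1/2}` as a continuous linear map. -/
noncomputable def invSqrtCLM (A : Matrix (Fin k) (Fin k) ℝ) :
    EuclideanSpace ℝ (Fin k) →L[ℝ] EuclideanSpace ℝ (Fin k) :=
  LinearMap.toContinuousLinearMap (Matrix.toEuclideanLin (CFC.sqrt A⁻¹))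

lemma invSqrtMul_eq (A : Matrix (Fin k) (Fin k) ℝ) (v : EuclideanSpace ℝ (Fin k)) :
    invSqrtMul A v = invSqrtCLM A v := rfl

lemma norm_toEuclideanLin_sqrt_sq {A : Matrix (Fin k) (Fin k) ℝ} (hA : A.PosSemidef)
    (v : EuclideanSpace ℝ (Fin k)) :
    ‖Matrix.toEuclideanLin (CFC.sqrt A) v‖ ^ 2 = v.ofLp ⬝ᵥ A *ᵥ v.ofLp := by
  have hs : (CFC.sqrt A)ᵀ = CFC.sqrt A := by
    have := (CFC.sqrt_nonneg A).isSelfAdjoint.star_eq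
    rwa [Matrix.star_eq_conjTranspose, Matrix.conjTranspose_eq_transpose_of_trivial] at this
  have h1 : ‖Matrix.toEuclideanLin (CFC.sqrt A) v‖ ^ 2
      = (CFC.sqrt A *ᵥ v.ofLp) ⬝ᵥ (CFC.sqrt A *ᵥ v.ofLp) := by
    rw [EuclideanSpace.real_norm_sq_eq, dotProduct]
    simp [sq]
  rw [h1, dotProduct_mulVec, ← hs, vecMul_transpose, hs, mulVec_mulVec,
    CFC.sqrt_mul_sqrt_self A hA.nonneg, dotProduct_comm]

lemma sqrt_smul_of_nonneg {A : Matrix (Fin k) (Fin k) ℝ} (hA : A.PosSemidef) {c : ℝ} (hc : 0 ≤ c) :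
    CFC.sqrt (c • A) = √c • CFC.sqrt A := by
  refine CFC.sqrt_unique ?_ (smul_nonneg (Real.sqrt_nonneg c) (CFC.sqrt_nonneg A))
  rw [smul_mul_smul_comm, CFC.sqrt_mul_sqrt_self A hA.nonneg, Real.mul_self_sqrt hc]

lemma invSqrtMul_smul {A : Matrix (Fin k) (Fin k) ℝ} (hA : A.PosDef) {c : ℝ} (hc : 0 < c)
    (v : EuclideanSpace ℝ (Fin k)) : invSqrtMul (c • A) v = (√c)⁻¹ • invSqrtCLM A v := by
  have h1 : (c • A)⁻¹ = c⁻¹ • A⁻¹ := by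
    have hu : IsUnit A.det := (Matrix.isUnit_iff_isUnit_det A).1 hA.isUnit
    refine Matrix.inv_eq_left_inv ?_
    rw [smul_mul_smul_comm, inv_mul_cancel₀ hc.ne', one_smul, Matrix.nonsing_inv_mul A hu]
  rw [← invSqrtMul_eq, invSqrtMul, invSqrtMul, h1,
    sqrt_smul_of_nonneg hA.inv.posSemidef (inv_nonneg.2 hc.le), Real.sqrt_inv, map_smul]
  rfl

/-- The square root of `I` is injective on a finite-dimensional space, hence bounded below. -/
lemma PosDef.exists_coercive {I : Matrix (Fin h) (Fin h) ℝ} (hI : I.PosDef) :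
    ∃ lam > 0, ∀ v : EuclideanSpace ℝ (Fin h), lam * ‖v‖ ^ 2 ≤ v.ofLp ⬝ᵥ I *ᵥ v.ofLp := by
  have hker : LinearMap.ker (Matrix.toEuclideanLin (CFC.sqrt I)) = ⊥ := by
    rw [LinearMap.ker_eq_bot']
    intro v hv
    by_contra hne
    have h1 := norm_toEuclideanLin_sqrt_sq hI.posSemidef v
    have h2 := hI.dotProduct_mulVec_pos (x := v.ofLp) (fun h0 => hne (by
      ext i; simpa using congrFun h0 i))
    rw [hv, norm_zero] at h1
    simp only [star_trivial] at h2
    rw [← h1] at h2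
    norm_num at h2
  obtain ⟨K, hK, hanti⟩ := LinearMap.exists_antilipschitzWith _ hker
  refine ⟨((K : ℝ) ^ 2)⁻¹, by positivity, fun v => ?_⟩
  have h1 := hanti.le_mul_dist v 0
  rw [dist_zero_right, map_zero, dist_zero_right] at h1
  rw [← norm_toEuclideanLin_sqrt_sq hI.posSemidef v, inv_mul_le_iff₀ (by positivity), ← mul_pow]
  gcongr

/-- `G I⁻¹ Gᵀ` is positive definite when the Jacobian `G` has full rank. -/
lemma posDef_mul_inv_mul_transpose {I : Matrix (Fin h) (Fin h) ℝ} (hI : I.PosDef)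
    {J : Matrix (Fin k) (Fin h) ℝ} (hJ : Function.Surjective fun v => J *ᵥ v) :
    (J * I⁻¹ * Jᵀ).PosDef := by
  rw [← Matrix.conjTranspose_eq_transpose_of_trivial]
  refine hI.inv.mul_mul_conjTranspose_same ?_
  intro x y hxy
  have hxy : x ᵥ* J = y ᵥ* J := hxy
  have h0 : ∀ z, (x - y) ⬝ᵥ z = 0 := fun z => by
    obtain ⟨v, rfl⟩ := hJ z
    rw [dotProduct_mulVec, sub_vecMul, hxy, sub_self, zero_dotProduct]
  exact sub_eq_zero.1 (dotProduct_self_eq_zero.1 (h0 (x - y)))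

lemma ofLp_fderiv_eq_jacobian_mulVec (θ : EuclideanSpace ℝ (Fin h) → EuclideanSpace ℝ (Fin k))
    (ψ v : EuclideanSpace ℝ (Fin h)) :
    (fderiv ℝ θ ψ v).ofLp = jacobian θ ψ *ᵥ v.ofLp := by
  ext i
  conv_lhs => rw [← (EuclideanSpace.basisFun (Fin h) ℝ).sum_repr v]
  simp [jacobian, mulVec, dotProduct, mul_comm]

lemma surjective_jacobian_mulVec {θ : EuclideanSpace ℝ (Fin h) → EuclideanSpace ℝ (Fin k)}
    {ψ : EuclideanSpace ℝ (Fin h)} (hG : Function.Surjective (fderiv ℝ θ ψ)) :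
    Function.Surjective fun v => jacobian θ ψ *ᵥ v := fun z => by
  obtain ⟨v, hv⟩ := hG (WithLp.toLp 2 z)
  exact ⟨v.ofLp, by simp only [← ofLp_fderiv_eq_jacobian_mulVec, hv]⟩

/-- The matrix `I⁻¹ Jᵀ C⁻¹`, with `C = J I⁻¹ Jᵀ`, gives a right inverse `Q` of `G` whose range is
`I`-orthogonal to the kernel of `G`. So `P = id - Q G` is the required projection, `⟪Q G v, I Q G v⟫
= ‖C^{-1/2} G v‖²`, and the inequality for `D` is Pythagoras. -/
lemma infoGeometry_of_posDef {I : Matrix (Fin h) (Fin h) ℝ} (hI : I.PosDef)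
    {G : EuclideanSpace ℝ (Fin h) →L[ℝ] EuclideanSpace ℝ (Fin k)} {J : Matrix (Fin k) (Fin h) ℝ}
    (hGJ : ∀ v, (G v).ofLp = J *ᵥ v.ofLp) (hC : (J * I⁻¹ * Jᵀ).PosDef) :
    ∃ P lam, InfoGeometry (Matrix.toEuclideanCLM (𝕜 := ℝ) I) G
      ((invSqrtCLM (J * I⁻¹ * Jᵀ)).comp G) (invSqrtCLM (J * I⁻¹ * Jᵀ)) P lam := by
  obtain ⟨lam, hlam, hcoer⟩ := PosDef.exists_coercive hI
  set C := J * I⁻¹ * Jᵀ with hCdef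
  have hIu : IsUnit I.det := (Matrix.isUnit_iff_isUnit_det I).1 hI.isUnit
  have hCu : IsUnit C.det := (Matrix.isUnit_iff_isUnit_det C).1 hC.isUnit
  have hIt : Iᵀ = I := by
    rw [← Matrix.conjTranspose_eq_transpose_of_trivial]; exact hI.isHermitian
  set Q : EuclideanSpace ℝ (Fin k) →L[ℝ] EuclideanSpace ℝ (Fin h) :=
    LinearMap.toContinuousLinearMap (Matrix.toEuclideanLin (I⁻¹ * Jᵀ * C⁻¹)) with hQ
  have hQv : ∀ x, (Q x).ofLp = (I⁻¹ * Jᵀ * C⁻¹) *ᵥ x.ofLp := fun x => rfl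
  have hsymm : ∀ x y, ⟪Matrix.toEuclideanCLM (𝕜 := ℝ) I x, y⟫
      = ⟪x, Matrix.toEuclideanCLM (𝕜 := ℝ) I y⟫ := fun x y => by
    rw [real_inner_comm, inner_toEuclideanCLM, inner_toEuclideanCLM, dotProduct_mulVec,
      ← mulVec_transpose, hIt, dotProduct_comm]
  have hJQ : ∀ x : EuclideanSpace ℝ (Fin k), J *ᵥ (Q x).ofLp = x.ofLp := fun x => by
    rw [hQv, mulVec_mulVec, ← Matrix.mul_assoc, ← Matrix.mul_assoc, ← hCdef,
      Matrix.mul_nonsing_inv C hCu, one_mulVec]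
  have hIQ : ∀ x : EuclideanSpace ℝ (Fin k), I *ᵥ (Q x).ofLp = Jᵀ *ᵥ (C⁻¹ *ᵥ x.ofLp) := fun x => by
    rw [hQv, mulVec_mulVec, mulVec_mulVec, ← Matrix.mul_assoc, ← Matrix.mul_assoc,
      Matrix.mul_nonsing_inv I hIu, Matrix.one_mul]
  have hIJ : ∀ (u : EuclideanSpace ℝ (Fin h)) (x : EuclideanSpace ℝ (Fin k)),
      ⟪u, Matrix.toEuclideanCLM (𝕜 := ℝ) I (Q x)⟫ = (J *ᵥ u.ofLp) ⬝ᵥ (C⁻¹ *ᵥ x.ofLp) := fun u x => by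
    rw [inner_toEuclideanCLM, hIQ, dotProduct_mulVec, vecMul_transpose]
  have hD : ∀ v, ‖(invSqrtCLM C).comp G v‖ ^ 2 = (G v).ofLp ⬝ᵥ C⁻¹ *ᵥ (G v).ofLp := fun v =>
    norm_toEuclideanLin_sqrt_sq hC.inv.posSemidef (G v)
  have hsub : ∀ v, ⟪Q (G v), Matrix.toEuclideanCLM (𝕜 := ℝ) I (Q (G v))⟫
      = ‖(invSqrtCLM C).comp G v‖ ^ 2 := fun v => by
    rw [hIJ, hJQ, hD]
  have hGQ : ∀ v, G (v - Q (G v)) = 0 := fun v => by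
    have : (G (v - Q (G v))).ofLp = 0 := by
      rw [map_sub, WithLp.ofLp_sub, hGJ (Q (G v)), hJQ, sub_self]
    ext i
    simpa using congrFun this i
  refine ⟨ContinuousLinearMap.id ℝ _ - Q.comp G, lam, hsymm, hlam, ?_, ?_, fun v => rfl, ?_, ?_⟩
  · intro v
    rw [inner_toEuclideanCLM]
    exact hcoer v
  · intro v
    have hcross : ⟪v - Q (G v), Matrix.toEuclideanCLM (𝕜 := ℝ) I (Q (G v))⟫ = 0 := by
      rw [hIJ, ← hGJ, hGQ, WithLp.ofLp_zero, zero_dotProduct]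
    have hpos : 0 ≤ ⟪v - Q (G v), Matrix.toEuclideanCLM (𝕜 := ℝ) I (v - Q (G v))⟫ := by
      rw [inner_toEuclideanCLM]
      exact (by positivity : 0 ≤ lam * ‖v - Q (G v)‖ ^ 2).trans (hcoer _)
    have hexp : ⟪v, Matrix.toEuclideanCLM (𝕜 := ℝ) I v⟫
        = ⟪v - Q (G v), Matrix.toEuclideanCLM (𝕜 := ℝ) I (v - Q (G v))⟫
          + 2 * ⟪v - Q (G v), Matrix.toEuclideanCLM (𝕜 := ℝ) I (Q (G v))⟫
          + ⟪Q (G v), Matrix.toEuclideanCLM (𝕜 := ℝ) I (Q (G v))⟫ := by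
      have e : v = (v - Q (G v)) + Q (G v) := by abel
      conv_lhs => rw [e]
      generalize v - Q (G v) = p
      generalize Q (G v) = q
      rw [map_add, inner_add_left, inner_add_right, inner_add_right, ← hsymm q p,
        real_inner_comm p]
      ring
    rw [hexp, hcross, hsub]
    linarith
  · intro v
    exact hGQ v
  · intro v
    have : v - (ContinuousLinearMap.id ℝ (EuclideanSpace ℝ (Fin h)) - Q.comp G) v = Q (G v) := by
      simp
    rw [this, hsub]

lemma inner_toEuclideanCLM_self_eq_sum (I : Matrix (Fin h) (Fin h) ℝ)
    (v : EuclideanSpace ℝ (Fin h)) :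
    ⟪v, Matrix.toEuclideanCLM (𝕜 := ℝ) I v⟫ = ∑ i, ∑ j, v i * v j * I i j := by
  rw [inner_toEuclideanCLM, dotProduct]
  refine Finset.sum_congr rfl fun i _ => ?_
  rw [mulVec, dotProduct, Finset.mul_sum]
  exact Finset.sum_congr rfl fun j _ => by ring

lemma exists_toEuclideanCLM_eq {I : Matrix (Fin h) (Fin h) ℝ} (hI : I.PosDef)
    (g : EuclideanSpace ℝ (Fin h)) : ∃ w, Matrix.toEuclideanCLM (𝕜 := ℝ) I w = g := by
  have hIu : IsUnit I.det := (Matrix.isUnit_iff_isUnit_det I).1 hI.isUnit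
  refine ⟨Matrix.toEuclideanCLM (𝕜 := ℝ) I⁻¹ g, ?_⟩
  rw [← mul_apply_eq_comp, ← map_mul, Matrix.mul_nonsing_inv I hIu, map_one]
  rfl

end MatrixGeometry

/-! ### Gaussian vectors and the two chi-squared variables -/

section Gaussian

open scoped RealInnerProductSpace

/-- The characteristic function depends only on `‖∑ t i • v i‖ = ‖t‖`. The family need not span,
which matters below. -/
lemma orthonormal_map_stdGaussian {ι F : Type*} [Fintype ι] [NormedAddCommGroup F]
    [InnerProductSpace ℝ F] [FiniteDimensional ℝ F] [MeasurableSpace F] [BorelSpace F] {v : ι → F}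
    (hv : Orthonormal ℝ v) :
    (stdGaussian F).map (fun x i => ⟪v i, x⟫) = Measure.pi fun _ : ι => gaussianReal 0 1 := by
  have hmeas : Measurable fun (x : F) (i : ι) => ⟪v i, x⟫ := by fun_prop
  refine (MeasurableEquiv.toLp 2 (ι → ℝ)).map_measurableEquiv_injective ?_
  rw [MeasurableEquiv.coe_toLp, map_pi_eq_stdGaussian, Measure.map_map (by fun_prop) hmeas]
  refine Measure.ext_of_charFun (funext fun t => ?_)
  have h1 : ∀ x : F, ⟪(WithLp.toLp 2 fun i => ⟪v i, x⟫ : EuclideanSpace ℝ ι), t⟫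
      = ⟪x, ∑ i, t i • v i⟫ := fun x => by
    rw [PiLp.inner_apply, inner_sum]
    refine Finset.sum_congr rfl fun i _ => ?_
    simp [real_inner_smul_right, real_inner_comm]
  have h2 : ‖∑ i, t i • v i‖ ^ 2 = ‖t‖ ^ 2 := by
    rw [← real_inner_self_eq_norm_sq, hv.inner_sum, EuclideanSpace.real_norm_sq_eq]
    simp [sq]
  rw [charFun_stdGaussian, ← Complex.ofReal_pow, ← h2, Complex.ofReal_pow, ← charFun_stdGaussian,
    charFun_apply, charFun_apply, integral_map (by fun_prop) (by fun_prop)]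
  simp only [Function.comp_apply, h1]

lemma map_pi_gaussianReal_sum_sq (ι : Type*) [Fintype ι] {d : ℕ} (hd : Fintype.card ι = d) :
    (Measure.pi fun _ : ι => gaussianReal 0 1).map (fun x => ∑ i, x i ^ 2) = chiSq d := by
  have e : Fin d ≃ ι := (Fintype.equivFinOfCardEq hd).symm
  have hmp := measurePreserving_piCongrLeft (fun _ : ι => gaussianReal 0 1) e
  rw [chiSq, ← hmp.map_eq, Measure.map_map (by fun_prop) (by fun_prop)]
  congr 1
  ext x
  simp only [Function.comp_apply]
  rw [← e.sum_comp]
  simp [MeasurableEquiv.coe_piCongrLeft]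

lemma map_pi_sum_gaussianReal_sum_sq (ι₁ ι₂ : Type*) [Fintype ι₁] [Fintype ι₂] {d₁ d₂ : ℕ}
    (h₁ : Fintype.card ι₁ = d₁) (h₂ : Fintype.card ι₂ = d₂) :
    (Measure.pi fun _ : ι₁ ⊕ ι₂ => gaussianReal 0 1).map
      (fun x => (∑ i, x (.inl i) ^ 2, ∑ i, x (.inr i) ^ 2)) = (chiSq d₁).prod (chiSq d₂) := by
  have hmp := measurePreserving_sumPiEquivProdPi (fun _ : ι₁ ⊕ ι₂ => gaussianReal 0 1)
  rw [← map_pi_gaussianReal_sum_sq ι₁ h₁, ← map_pi_gaussianReal_sum_sq ι₂ h₂,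
    Measure.map_prod_map _ _ (by fun_prop) (by fun_prop), ← hmp.map_eq,
    Measure.map_map (by fun_prop) (by fun_prop)]
  rfl

/-- A Helmert-type basis: the first coordinate is the rescaled sample mean, the others are
contrasts. -/
lemma exists_orthonormalBasis_const (p : ℕ) :
    ∃ O : OrthonormalBasis (Fin (p + 1)) ℝ (EuclideanSpace ℝ (Fin (p + 1))),
      ∀ l, O 0 l = (√((p : ℝ) + 1))⁻¹ := by
  have hp : (0 : ℝ) < (p : ℝ) + 1 := by positivity
  have hv : Orthonormal ℝ (({0} : Set (Fin (p + 1))).domRestrict fun _ : Fin (p + 1) =>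
      (WithLp.toLp 2 fun _ => (√((p : ℝ) + 1))⁻¹ : EuclideanSpace ℝ (Fin (p + 1)))) := by
    refine ⟨fun i => ?_, fun i j hij => absurd (Subsingleton.elim i j) hij⟩
    have : ‖(WithLp.toLp 2 fun _ => (√((p : ℝ) + 1))⁻¹ : EuclideanSpace ℝ (Fin (p + 1)))‖ ^ 2
        = 1 := by
      rw [EuclideanSpace.real_norm_sq_eq]
      simp [Real.sq_sqrt hp.le, mul_inv_cancel₀ hp.ne']
    exact (pow_eq_one_iff_of_nonneg (norm_nonneg _) two_ne_zero).1 this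
  obtain ⟨O, hO⟩ := hv.exists_orthonormalBasis_extension_of_card_eq (by simp)
  exact ⟨O, fun l => by rw [hO 0 rfl]⟩

/-- Standard normal variables: one for the observed data, one for each imputation. -/
abbrev ImputationSpace (k m : ℕ) : Type :=
  PiLp 2 fun _ : Fin (m + 1) => EuclideanSpace ℝ (Fin k)

variable {k m : ℕ}

/-- The limit of the standardized complete-data estimators in terms of standard normal variables. -/
noncomputable def combined (r : ℝ) (x : ImputationSpace k m) (l : Fin m) :
    EuclideanSpace ℝ (Fin k) :=
  √(1 + r) • x 0 + √r • x l.succ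

/-- Mean of the `m` squared norms. -/
noncomputable def meanSq (W : Fin m → EuclideanSpace ℝ (Fin k)) : ℝ :=
  (1 / (m : ℝ)) * ∑ l, ‖W l‖ ^ 2

/-- Squared norm of the mean. -/
noncomputable def sqMean (W : Fin m → EuclideanSpace ℝ (Fin k)) : ℝ :=
  ‖(1 / (m : ℝ)) • ∑ l, W l‖ ^ 2

/-- Cochran's decomposition, with `p + 1` imputations. The common term `√(1 + r) • x 0` cancels in
the dispersion, leaving `r / (p + 1)` times a sum of `k * p` squared contrasts. The standardized
mean and these contrasts are coordinates along one orthonormal family, so they are independent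
standard normal. -/
theorem map_stdGaussian_combined {p : ℕ} {r rm : ℝ} (hr : 0 < r)
    (hrm : rm = (1 + 1 / ((p + 1 : ℕ) : ℝ)) * r) :
    (stdGaussian (ImputationSpace k (p + 1))).map (fun x => ((1 + rm)⁻¹ * sqMean (combined r x),
      (((p + 1 : ℕ) : ℝ) / r) * (meanSq (combined r x) - sqMean (combined r x))))
      = (chiSq k).prod (chiSq (k * p)) := by
  obtain ⟨O, hO⟩ := exists_orthonormalBasis_const p
  set M : ℝ := ((p + 1 : ℕ) : ℝ) with hM
  have hMp : M = (p : ℝ) + 1 := by rw [hM]; push_cast; ring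
  have hM0 : 0 < M := by rw [hMp]; positivity
  have hrm0 : 0 < 1 + rm := by rw [hrm]; positivity
  rw [← hMp] at hO
  have hsM : 0 < √M := Real.sqrt_pos.2 hM0
  have hOO : ∀ i j, ∑ l, O i l * O j l = if i = j then 1 else 0 := fun i j => by
    have := orthonormal_iff_ite.1 O.orthonormal i j
    rw [← this, PiLp.inner_apply]
    exact Finset.sum_congr rfl fun l _ => by simp [mul_comm]
  have hOs : ∀ j : Fin p, ∑ l, O j.succ l = 0 := fun j => by
    have h1 := hOO j.succ 0
    simp only [hO, ← Finset.sum_mul, Fin.succ_ne_zero, if_false] at h1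
    rcases mul_eq_zero.1 h1 with h | h
    · exact h
    · exact absurd h (inv_pos.2 hsM).ne'
  -- Parseval in the Helmert basis: a sum of squares is a mean part plus squared contrasts.
  have hOsq : ∀ v : Fin (p + 1) → ℝ, ∑ l, v l ^ 2 = M⁻¹ * (∑ l, v l) ^ 2
      + ∑ j : Fin p, (∑ l, O j.succ l * v l) ^ 2 := fun v => by
    have h1 := O.sum_sq_inner_right (WithLp.toLp 2 v)
    rw [EuclideanSpace.real_norm_sq_eq] at h1
    have h2 : ∀ j, ⟪O j, WithLp.toLp 2 v⟫ = ∑ l, O j l * v l := fun j => by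
      rw [PiLp.inner_apply]
      exact Finset.sum_congr rfl fun l _ => by simp [mul_comm]
    simp only [h2] at h1
    rw [← h1, Fin.sum_univ_succ]
    congr 1
    simp only [hO]
    rw [← Finset.mul_sum, mul_pow, inv_pow, Real.sq_sqrt hM0.le]
  set e : Fin k → EuclideanSpace ℝ (Fin k) := fun i => EuclideanSpace.single i 1 with he
  have hee : ∀ i j, ⟪e i, e j⟫ = if i = j then 1 else 0 := fun i j => by
    simp [he, EuclideanSpace.inner_single_left]
  -- The left vectors read off the coordinates of the mean of `combined` divided by `√(1 + rm)`; the
  -- right ones read off the contrasts of the imputation variables, with no component on the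
  -- observed-data variable.
  set u : Fin k ⊕ (Fin p × Fin k) → ImputationSpace k (p + 1) := Sum.elim
    (fun i => WithLp.toLp 2 (Fin.cons ((√(1 + r) / √(1 + rm)) • e i)
      fun _ => (√r / (M * √(1 + rm))) • e i))
    (fun q => WithLp.toLp 2 (Fin.cons 0 fun l => O q.1.succ l • e q.2)) with hu
  have hur : ∀ q x, ⟪u (.inr q), x⟫ = ∑ l, O q.1.succ l * x (Fin.succ l) q.2 := fun q x => by
    rw [PiLp.inner_apply, Fin.sum_univ_succ]
    simp [hu, he, real_inner_smul_left, EuclideanSpace.inner_single_left]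
  have hul : ∀ i x, ⟪u (.inl i), x⟫ = (√(1 + rm))⁻¹ * ((1 / M) * ∑ l, combined r x l i) := fun i x => by
    rw [PiLp.inner_apply, Fin.sum_univ_succ]
    simp only [hu, he, combined, Sum.elim_inl, Fin.cons_zero, Fin.cons_succ, real_inner_smul_left,
      EuclideanSpace.inner_single_left, PiLp.add_apply, PiLp.smul_apply, smul_eq_mul,
      Finset.sum_add_distrib, ← Finset.mul_sum, Finset.sum_const, Finset.card_univ,
      Fintype.card_fin, nsmul_eq_mul, map_one, one_mul, ← hM]
    field_simp
  have hs1 : √(1 + rm) ^ 2 = 1 + rm := Real.sq_sqrt hrm0.le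
  have hs2 : √(1 + r) ^ 2 = 1 + r := Real.sq_sqrt (by positivity)
  have hs3 : √r ^ 2 = r := Real.sq_sqrt hr.le
  have hs0 : 0 < √(1 + rm) := Real.sqrt_pos.2 hrm0
  have horth : Orthonormal ℝ u := by
    rw [orthonormal_iff_ite]
    rintro (i | ⟨j, i⟩) (i' | ⟨j', i'⟩)
    · rw [PiLp.inner_apply, Fin.sum_univ_succ]
      simp only [hu, Sum.elim_inl, Fin.cons_zero, Fin.cons_succ, real_inner_smul_left,
        real_inner_smul_right, hee, Finset.sum_const, Finset.card_univ,
        Fintype.card_fin, nsmul_eq_mul, ← hM, Sum.inl.injEq]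
      by_cases hii : i = i'
      · simp only [if_pos hii, mul_one]
        -- The unit length of the mean vectors is the identity `1 + r + r / m = 1 + rm`.
        have : √(1 + r) / √(1 + rm) * (√(1 + r) / √(1 + rm))
            + M * (√r / (M * √(1 + rm)) * (√r / (M * √(1 + rm))))
            = (√(1 + r) ^ 2 + √r ^ 2 / M) / √(1 + rm) ^ 2 := by
          field_simp
        rw [this, hs1, hs2, hs3, div_eq_one_iff_eq hrm0.ne', hrm]
        ring
      · simp [hii]
    · rw [real_inner_comm, hur]
      simp [hu, he, mul_comm _ (√r / (M * √(1 + rm))), ← Finset.mul_sum, hOs]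
    · rw [hur]
      simp [hu, he, mul_comm _ (√r / (M * √(1 + rm))), ← Finset.mul_sum, hOs]
    · rw [hur]
      have : ∀ l, (u (.inr (j', i'))) (Fin.succ l) i = O j'.succ l * if i = i' then 1 else 0 :=
        fun l => by simp [hu, he]
      simp only [this, ← mul_assoc, ← Finset.sum_mul, hOO, Fin.succ_inj, Sum.inr.injEq,
        Prod.mk.injEq]
      by_cases h1 : j = j' <;> by_cases h2 : i = i' <;> simp [h1, h2]
  have hcard : Fintype.card (Fin p × Fin k) = k * p := by simp [mul_comm]
  rw [← map_pi_sum_gaussianReal_sum_sq (Fin k) (Fin p × Fin k) (Fintype.card_fin k) hcard,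
    ← orthonormal_map_stdGaussian horth, Measure.map_map (by fun_prop) (by fun_prop)]
  congr 1
  ext1 x
  have hsq : sqMean (combined r x) = ∑ i, ((1 / M) * ∑ l, combined r x l i) ^ 2 := by
    rw [sqMean, EuclideanSpace.real_norm_sq_eq]
    simp [hM]
  simp only [Function.comp_apply, Prod.mk.injEq]
  constructor
  · rw [hsq, Finset.mul_sum]
    refine Finset.sum_congr rfl fun i _ => ?_
    rw [hul, mul_pow (√(1 + rm))⁻¹, inv_pow, hs1]
  · rw [hsq, meanSq, Fintype.sum_prod_type_right]
    simp only [EuclideanSpace.real_norm_sq_eq]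
    rw [Finset.sum_comm, ← hM, Finset.mul_sum, ← Finset.sum_sub_distrib, Finset.mul_sum]
    refine Finset.sum_congr rfl fun i _ => ?_
    simp only [hur]
    have h1 := hOsq fun l => x (Fin.succ l) i
    have h2 : ∑ l, combined r x l i = M * (√(1 + r) * x 0 i) + √r * ∑ l, x (Fin.succ l) i := by
      simp [combined, Finset.sum_add_distrib, ← Finset.mul_sum, hM]
    have h3 : ∑ l, combined r x l i ^ 2 = M * (√(1 + r) * x 0 i) ^ 2
        + 2 * (√(1 + r) * x 0 i) * √r * ∑ l, x (Fin.succ l) i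
        + √r ^ 2 * ∑ l, x (Fin.succ l) i ^ 2 := by
      simp only [combined, PiLp.add_apply, PiLp.smul_apply, smul_eq_mul, add_sq,
        Finset.sum_add_distrib, Finset.sum_const, Finset.card_univ, Fintype.card_fin, nsmul_eq_mul,
        ← hM, mul_pow, ← Finset.mul_sum]
      ring
    rw [h2, h3, h1, hs3]
    generalize ∑ j : Fin p, (∑ l, O j.succ l * x (Fin.succ l) i) ^ 2 = Q
    generalize ∑ l : Fin (p + 1), x (Fin.succ l) i = S
    generalize √(1 + r) * x 0 i = a
    have : (1 / M * (M * a + √r * S)) ^ 2 = a ^ 2 + 2 * a * √r * S / M + √r ^ 2 * S ^ 2 / M ^ 2 := by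
      field_simp
      ring
    rw [this, hs3]
    field_simp
    ring

end Gaussian

/-! ### Joint law of conditionally independent imputations -/

section Kernels

variable {𝒴 𝒵 : Type*} [MeasurableSpace 𝒴] [MeasurableSpace 𝒵] {m : ℕ}

/-- `m` conditionally independent draws from a Markov kernel. -/
noncomputable def piKernel (κ : Kernel 𝒴 𝒵) [IsMarkovKernel κ] (m : ℕ) :
    Kernel 𝒴 (Fin m → 𝒵) where
  toFun y := Measure.pi fun _ => κ y
  measurable' := by
    refine Measurable.measure_of_isPiSystem_of_isProbabilityMeasure generateFrom_pi.symm
      isPiSystem_pi ?_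
    rintro _ ⟨B, hB, rfl⟩
    simp only [Measure.pi_pi]
    exact Finset.measurable_prod _ fun l _ => κ.measurable_coe (hB l (Set.mem_univ l))

lemma piKernel_apply (κ : Kernel 𝒴 𝒵) [IsMarkovKernel κ] (m : ℕ) (y : 𝒴) :
    piKernel κ m y = Measure.pi fun _ => κ y := rfl

instance (κ : Kernel 𝒴 𝒵) [IsMarkovKernel κ] (m : ℕ) : IsMarkovKernel (piKernel κ m) :=
  ⟨fun y => by rw [piKernel_apply]; infer_instance⟩

/-- Conditional independence prescribes the law on rectangles, a generating π-system. -/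
lemma map_eq_compProd_piKernel {Ω : Type*} [MeasurableSpace Ω] {P : Measure Ω}
    [IsProbabilityMeasure P] {Q : Measure 𝒴} [IsProbabilityMeasure Q] {κ : Kernel 𝒴 𝒵}
    [IsMarkovKernel κ] {Y : Ω → 𝒴} {Z : Fin m → Ω → 𝒵} (hY : Measurable Y)
    (hZ : ∀ l, Measurable (Z l))
    (hind : ∀ A : Set 𝒴, MeasurableSet A → ∀ B : Fin m → Set 𝒵, (∀ l, MeasurableSet (B l)) →
      P {ω | Y ω ∈ A ∧ ∀ l, Z l ω ∈ B l} = ∫⁻ y in A, ∏ l, κ y (B l) ∂Q) :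
    P.map (fun ω => (Y ω, fun l => Z l ω)) = Q ⊗ₘ piKernel κ m := by
  have hmeas : Measurable fun ω => (Y ω, fun l => Z l ω) := by fun_prop
  have : IsProbabilityMeasure (P.map fun ω => (Y ω, fun l => Z l ω)) :=
    Measure.isProbabilityMeasure_map hmeas.aemeasurable
  refine ext_of_generate_finite _ (generateFrom_eq_prod
    (@MeasurableSpace.generateFrom_measurableSet 𝒴 _) generateFrom_pi
    isCountablySpanning_measurableSet
    (IsCountablySpanning.pi fun _ => isCountablySpanning_measurableSet)).symm
    (MeasurableSpace.isPiSystem_measurableSet.prod isPiSystem_pi) ?_ (by simp)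
  rintro _ ⟨A, hA, _, ⟨B, hB, rfl⟩, rfl⟩
  have hB' : ∀ l, MeasurableSet (B l) := fun l => hB l (Set.mem_univ l)
  have hpi : MeasurableSet (Set.univ.pi B) := MeasurableSet.univ_pi hB'
  rw [Measure.map_apply hmeas (hA.prod hpi), Measure.compProd_apply_prod hA hpi]
  simp only [piKernel_apply, Measure.pi_pi]
  rw [← hind A hA B hB']
  congr 1
  ext ω
  simp

/-- Leaving all other imputations unrestricted identifies the law of one completed data set, the law
for which the likelihood regularity is assumed. -/
lemma map_prodMk_eq_compProd {Ω : Type*} [MeasurableSpace Ω] {P : Measure Ω}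
    [IsProbabilityMeasure P] {Q : Measure 𝒴} [IsProbabilityMeasure Q] {κ : Kernel 𝒴 𝒵}
    [IsMarkovKernel κ] {Y : Ω → 𝒴} {Z : Fin m → Ω → 𝒵} (hY : Measurable Y)
    (hZ : ∀ l, Measurable (Z l))
    (hind : ∀ A : Set 𝒴, MeasurableSet A → ∀ B : Fin m → Set 𝒵, (∀ l, MeasurableSet (B l)) →
      P {ω | Y ω ∈ A ∧ ∀ l, Z l ω ∈ B l} = ∫⁻ y in A, ∏ l, κ y (B l) ∂Q) (l : Fin m) :
    P.map (fun ω => (Y ω, Z l ω)) = Q ⊗ₘ κ := by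
  have hmeas : Measurable fun ω => (Y ω, Z l ω) := by fun_prop
  have : IsProbabilityMeasure (P.map fun ω => (Y ω, Z l ω)) :=
    Measure.isProbabilityMeasure_map hmeas.aemeasurable
  refine ext_of_generate_finite _ generateFrom_prod.symm isPiSystem_prod ?_ (by simp)
  rintro _ ⟨A, hA, B, hB, rfl⟩
  rw [Measure.map_apply hmeas (hA.prod hB), Measure.compProd_apply_prod hA hB]
  have h1 := hind A hA (fun j => if j = l then B else Set.univ) (fun j => by
    split_ifs
    · exact hB
    · exact MeasurableSet.univ)
  have h2 : {ω | Y ω ∈ A ∧ ∀ j, Z j ω ∈ (if j = l then B else Set.univ)}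
      = (fun ω => (Y ω, Z l ω)) ⁻¹' A ×ˢ B := by
    ext ω
    constructor
    · rintro ⟨h1, h2⟩
      exact ⟨h1, by simpa using h2 l⟩
    · rintro ⟨h1, h2⟩
      refine ⟨h1, fun j => ?_⟩
      split_ifs with h
      · rw [h]; exact h2
      · trivial
  rw [← h2, h1]
  refine lintegral_congr fun y => ?_
  rw [Finset.prod_eq_single l (fun j _ hj => by simp [hj]) (by simp)]
  simp

end Kernels

/-! ### Estimates for conditional characteristic functions -/

section CharFun

open scoped RealInnerProductSpace

lemma norm_prod_sub_prod_le_sum {ι : Type*} (s : Finset ι) {a b : ι → ℂ} (ha : ∀ i, ‖a i‖ ≤ 1)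
    (hb : ∀ i, ‖b i‖ ≤ 1) : ‖∏ i ∈ s, a i - ∏ i ∈ s, b i‖ ≤ ∑ i ∈ s, ‖a i - b i‖ := by
  classical
  induction s using Finset.induction_on with
  | empty => simp
  | insert i s hi ih =>
    rw [Finset.prod_insert hi, Finset.prod_insert hi, Finset.sum_insert hi]
    have e : a i * ∏ j ∈ s, a j - b i * ∏ j ∈ s, b j
        = (a i - b i) * ∏ j ∈ s, a j + b i * (∏ j ∈ s, a j - ∏ j ∈ s, b j) := by ring
    have h1 : ‖∏ j ∈ s, a j‖ ≤ 1 := by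
      rw [norm_prod]
      exact Finset.prod_le_one (fun _ _ => norm_nonneg _) fun j _ => ha j
    rw [e]
    refine (norm_add_le _ _).trans (add_le_add ?_ ?_)
    · rw [norm_mul]
      exact mul_le_of_le_one_right (norm_nonneg _) h1
    · rw [norm_mul]
      exact (mul_le_of_le_one_left (norm_nonneg _) (hb i)).trans ih

/-- Bounded convergence in probability over varying spaces: the integral is at most `ε / 2 + c * Q n
{ε / 2 ≤ u n}`. -/
lemma tendsto_integral_of_tendsto_measure {𝒴 : ℕ → Type*} [∀ n, MeasurableSpace (𝒴 n)]
    {Q : ∀ n, Measure (𝒴 n)} [∀ n, IsProbabilityMeasure (Q n)] {u : ∀ n, 𝒴 n → ℝ}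
    (hu : ∀ n, Measurable (u n)) {c : ℝ} (hu0 : ∀ n y, 0 ≤ u n y) (huc : ∀ n y, u n y ≤ c)
    (hlim : ∀ ε > 0, Tendsto (fun n => Q n {y | ε ≤ u n y}) atTop (𝓝 0)) :
    Tendsto (fun n => ∫ y, u n y ∂(Q n)) atTop (𝓝 0) := by
  have hint : ∀ n, Integrable (u n) (Q n) := fun n =>
    Integrable.of_bound (hu n).aestronglyMeasurable c (ae_of_all _ fun y => by
      rw [Real.norm_of_nonneg (hu0 n y)]; exact huc n y)
  rw [Metric.tendsto_atTop]
  intro ε hε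
  have h1 : Tendsto (fun n => ε / 2 + c * (Q n).real {y | ε / 2 ≤ u n y}) atTop
      (𝓝 (ε / 2 + c * 0)) := by
    refine tendsto_const_nhds.add (Tendsto.const_mul c ?_)
    exact (ENNReal.tendsto_toReal ENNReal.zero_ne_top).comp (hlim (ε / 2) (by positivity))
  obtain ⟨N, hN⟩ := eventually_atTop.1 (h1.eventually_lt_const (u := ε) (by linarith))
  refine ⟨N, fun n hn => ?_⟩
  have hms : MeasurableSet {y | ε / 2 ≤ u n y} := measurableSet_le measurable_const (hu n)
  have h0 : 0 ≤ ∫ y, u n y ∂(Q n) := integral_nonneg (hu0 n)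
  rw [Real.dist_eq, sub_zero, abs_of_nonneg h0]
  refine lt_of_le_of_lt ?_ (hN n hn)
  calc ∫ y, u n y ∂(Q n) ≤ ∫ y, (ε / 2 + {y | ε / 2 ≤ u n y}.indicator (fun _ => c) y) ∂(Q n) := by
        refine integral_mono (hint n) ((integrable_const _).add
          ((integrable_const c).indicator hms)) fun y => ?_
        by_cases hy : ε / 2 ≤ u n y
        · simp only [Set.indicator_of_mem (show y ∈ {y | ε / 2 ≤ u n y} from hy)]
          linarith [huc n y]
        · simp only [Set.indicator_of_notMem (show y ∉ {y | ε / 2 ≤ u n y} from hy)]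
          linarith [not_le.1 hy]
    _ = ε / 2 + c * (Q n).real {y | ε / 2 ≤ u n y} := by
        rw [integral_add (integrable_const _) ((integrable_const c).indicator hms),
          integral_indicator_const c hms]
        simp [mul_comm]

variable {E : Type*} [NormedAddCommGroup E] [InnerProductSpace ℝ E]

/-- Real part of a character. The convergence hypotheses concern real test functions, so
characteristic functions are split into this and `sinInner`. -/
noncomputable def cosInner (s : E) : E →ᵇ ℝ :=
  BoundedContinuousFunction.ofNormedAddCommGroup (fun x => Real.cos ⟪x, s⟫) (by fun_prop) 1
    fun x => Real.abs_cos_le_one _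

noncomputable def sinInner (s : E) : E →ᵇ ℝ :=
  BoundedContinuousFunction.ofNormedAddCommGroup (fun x => Real.sin ⟪x, s⟫) (by fun_prop) 1
    fun x => Real.abs_sin_le_one _

lemma norm_integral_exp_inner_le {X : Type*} [MeasurableSpace X] (μ : Measure X)
    [IsProbabilityMeasure μ] (f : X → E) (s : E) :
    ‖∫ x, Complex.exp (⟪f x, s⟫ * Complex.I) ∂μ‖ ≤ 1 := by
  refine (norm_integral_le_of_norm_le_const (ae_of_all _ fun x =>
    (Complex.norm_exp_ofReal_mul_I _).le)).trans ?_
  simp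

variable [MeasurableSpace E] [BorelSpace E]

lemma integral_exp_inner {X : Type*} [MeasurableSpace X] (μ : Measure X) [IsProbabilityMeasure μ]
    {f : X → E} (hf : Measurable f) (s : E) :
    ∫ x, Complex.exp (⟪f x, s⟫ * Complex.I) ∂μ
      = ((∫ x, cosInner s (f x) ∂μ : ℝ) : ℂ) + ((∫ x, sinInner s (f x) ∂μ : ℝ) : ℂ) * Complex.I := by
  have h1 : ∀ g : E →ᵇ ℝ, Integrable (fun x => ((g (f x) : ℝ) : ℂ)) μ := fun g =>
    Integrable.ofReal (Integrable.of_bound (g.continuous.measurable.comp hf).aestronglyMeasurable ‖g‖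
      (ae_of_all _ fun x => g.norm_coe_le_norm _))
  rw [← integral_complex_ofReal, ← integral_complex_ofReal, ← integral_mul_const,
    ← integral_add (h1 _) ((h1 _).mul_const _)]
  refine integral_congr_ae (ae_of_all _ fun x => ?_)
  simp [cosInner, sinInner, Complex.exp_mul_I]

end CharFun

/-! ### From conditional to joint convergence in distribution -/

section JointConvergence

open scoped RealInnerProductSpace

variable {k m : ℕ} {𝒴 𝒵 : ℕ → Type*} [∀ n, MeasurableSpace (𝒴 n)] [∀ n, MeasurableSpace (𝒵 n)]

/-- If `R n` is asymptotically standard normal and, conditionally on the observed data, so are the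
conditionally independent `V n`, then all of them are jointly asymptotically standard normal. -/
theorem tendstoInDistribution_imputations {Q : ∀ n, Measure (𝒴 n)}
    [∀ n, IsProbabilityMeasure (Q n)] {K : ∀ n, Kernel (𝒴 n) (𝒵 n)} [∀ n, IsMarkovKernel (K n)]
    {Ω : ℕ → Type*} [∀ n, MeasurableSpace (Ω n)] {P : ∀ n, Measure (Ω n)}
    [∀ n, IsProbabilityMeasure (P n)] {Y : ∀ n, Ω n → 𝒴 n} {Z : ∀ n, Fin m → Ω n → 𝒵 n}
    (hY : ∀ n, Measurable (Y n)) (hZ : ∀ n l, Measurable (Z n l))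
    (hind : ∀ n, ∀ A : Set (𝒴 n), MeasurableSet A → ∀ B : Fin m → Set (𝒵 n),
      (∀ l, MeasurableSet (B l)) →
      P n {ω | Y n ω ∈ A ∧ ∀ l, Z n l ω ∈ B l} = ∫⁻ y in A, ∏ l, K n y (B l) ∂(Q n))
    {R : ∀ n, 𝒴 n → EuclideanSpace ℝ (Fin k)} (hR : ∀ n, Measurable (R n))
    {V : ∀ n, 𝒴 n × 𝒵 n → EuclideanSpace ℝ (Fin k)} (hV : ∀ n, Measurable (V n))
    (hRlim : ∀ g : EuclideanSpace ℝ (Fin k) →ᵇ ℝ, Tendsto (fun n => ∫ y, g (R n y) ∂(Q n)) atTop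
      (𝓝 (∫ w, g w ∂(stdGaussian (EuclideanSpace ℝ (Fin k))))))
    (hVlim : ∀ g : EuclideanSpace ℝ (Fin k) →ᵇ ℝ, ∀ ε : ℝ, 0 < ε → Tendsto (fun n => Q n {y |
      ε ≤ |∫ z, g (V n (y, z)) ∂(K n y) - ∫ w, g w ∂(stdGaussian (EuclideanSpace ℝ (Fin k)))|})
      atTop (𝓝 0)) :
    TendstoInDistribution (fun n ω => (WithLp.toLp 2 (Fin.cons (R n (Y n ω))
        fun l => V n (Y n ω, Z n l ω)) : ImputationSpace k m)) atTop id P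
      (stdGaussian (ImputationSpace k m)) := by
  set γ := stdGaussian (EuclideanSpace ℝ (Fin k)) with hγ
  set X : ∀ n, 𝒴 n × (Fin m → 𝒵 n) → ImputationSpace k m := fun n p =>
    WithLp.toLp 2 (Fin.cons (R n p.1) fun l => V n (p.1, p.2 l)) with hX
  have hXmeas : ∀ n, Measurable (X n) := fun n => by
    refine (WithLp.measurable_toLp 2 _).comp (measurable_pi_iff.2 fun j => ?_)
    refine Fin.cases ?_ (fun l => ?_) j
    · exact (hR n).comp measurable_fst
    · simp only [Fin.cons_succ]
      exact (hV n).comp (measurable_fst.prodMk ((measurable_pi_apply l).comp measurable_snd))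
  have hpair : ∀ n, Measurable fun ω => (Y n ω, fun l => Z n l ω) := fun n => by fun_prop
  have hae : ∀ n, AEMeasurable (fun ω => X n (Y n ω, fun l => Z n l ω)) (P n) := fun n =>
    ((hXmeas n).comp (hpair n)).aemeasurable
  refine ⟨hae, measurable_id.aemeasurable, ProbabilityMeasure.tendsto_iff_tendsto_charFun.2 fun t => ?_⟩
  simp only [ProbabilityMeasure.coe_mk, Measure.map_id]
  -- the conditional characteristic functions
  set φ : ∀ n, 𝒴 n → Fin m → ℂ := fun n y l =>
    ∫ z, Complex.exp (⟪V n (y, z), t l.succ⟫ * Complex.I) ∂(K n y) with hφ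
  set c : Fin m → ℂ := fun l => charFun γ (t l.succ) with hc
  have hφmeas : ∀ n l, Measurable fun y => φ n y l := fun n l => by
    refine (StronglyMeasurable.integral_kernel_prod_right' (κ := K n)
      (f := fun p => Complex.exp (⟪V n p, t l.succ⟫ * Complex.I)) ?_).measurable
    have := hV n
    exact Measurable.stronglyMeasurable (by fun_prop)
  have hφ1 : ∀ n y l, ‖φ n y l‖ ≤ 1 := fun n y l => norm_integral_exp_inner_le _ _ _
  have hc1 : ∀ l, ‖c l‖ ≤ 1 := fun l => norm_charFun_le_one _
  have hcexp : ∀ s, charFun γ s = ((∫ x, cosInner s x ∂γ : ℝ) : ℂ)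
      + ((∫ x, sinInner s x ∂γ : ℝ) : ℂ) * Complex.I := fun s => by
    rw [charFun_apply]
    exact integral_exp_inner γ measurable_id s
  -- Given the observed data, the characteristic function factors over the imputations.
  have hchar : ∀ n, charFun ((P n).map fun ω => X n (Y n ω, fun l => Z n l ω)) t
      = ∫ y, Complex.exp (⟪R n y, t 0⟫ * Complex.I) * ∏ l, φ n y l ∂(Q n) := fun n => by
    have e1 : (P n).map (fun ω => X n (Y n ω, fun l => Z n l ω))
        = (Q n ⊗ₘ piKernel (K n) m).map (X n) := by
      rw [← map_eq_compProd_piKernel (hY n) (hZ n) (hind n), Measure.map_map (hXmeas n) (hpair n)]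
      rfl
    rw [e1, charFun_apply, integral_map (hXmeas n).aemeasurable (by fun_prop),
      Measure.integral_compProd]
    · refine integral_congr_ae (ae_of_all _ fun y => ?_)
      simp only [piKernel_apply]
      have e2 : ∀ z : Fin m → 𝒵 n, Complex.exp (⟪X n (y, z), t⟫ * Complex.I)
          = Complex.exp (⟪R n y, t 0⟫ * Complex.I)
            * ∏ l, Complex.exp (⟪V n (y, z l), t l.succ⟫ * Complex.I) := fun z => by
        rw [← Complex.exp_sum, ← Complex.exp_add, PiLp.inner_apply, Fin.sum_univ_succ]
        simp only [hX, Fin.cons_zero, Fin.cons_succ]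
        push_cast
        rw [add_mul, Finset.sum_mul]
      simp only [e2]
      rw [integral_const_mul, integral_fintype_prod_eq_prod
        (f := fun l z => Complex.exp (⟪V n (y, z), t (Fin.succ l)⟫ * Complex.I))]
    · have := hXmeas n
      refine Integrable.of_bound (Measurable.aestronglyMeasurable (by fun_prop)) 1
        (ae_of_all _ fun p => (Complex.norm_exp_ofReal_mul_I _).le)
  have hlimit : charFun (stdGaussian (ImputationSpace k m)) t = charFun γ (t 0) * ∏ l, c l := by
    simp only [hc, hγ, charFun_stdGaussian]
    rw [← Complex.exp_sum, ← Complex.exp_add]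
    congr 1
    have : ‖t‖ ^ 2 = ‖t 0‖ ^ 2 + ∑ l : Fin m, ‖t l.succ‖ ^ 2 := by
      rw [PiLp.norm_sq_eq_of_L2, Fin.sum_univ_succ]
    rw [← Finset.sum_div, ← add_div, Finset.sum_neg_distrib, ← neg_add]
    congr 2
    exact_mod_cast this
  have hRt : Tendsto (fun n => ∫ y, Complex.exp (⟪R n y, t 0⟫ * Complex.I) ∂(Q n)) atTop
      (𝓝 (charFun γ (t 0))) := by
    have e : ∀ n, ∫ y, Complex.exp (⟪R n y, t 0⟫ * Complex.I) ∂(Q n) = _ := fun n =>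
      integral_exp_inner (Q n) (hR n) (t 0)
    simp only [e, hcexp]
    exact ((Complex.continuous_ofReal.tendsto _).comp (hRlim (cosInner (t 0)))).add
      (((Complex.continuous_ofReal.tendsto _).comp (hRlim (sinInner (t 0)))).mul_const _)
  have hφlim : ∀ l, Tendsto (fun n => ∫ y, ‖φ n y l - c l‖ ∂(Q n)) atTop (𝓝 0) := fun l => by
    refine tendsto_integral_of_tendsto_measure (c := 2)
      (fun n => ((hφmeas n l).sub_const _).norm) (fun n y => norm_nonneg _)
      (fun n y => (norm_sub_le _ _).trans (by linarith [hφ1 n y l, hc1 l])) fun ε hε => ?_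
    -- A complex number of modulus at least `ε` has real or imaginary part at least `ε / 2` in
    -- absolute value.
    have h1 := (hVlim (cosInner (t l.succ)) (ε / 2) (by positivity)).add
      (hVlim (sinInner (t l.succ)) (ε / 2) (by positivity))
    rw [add_zero] at h1
    refine tendsto_of_tendsto_of_tendsto_of_le_of_le tendsto_const_nhds h1 (fun _ => zero_le)
      fun n => (measure_mono fun y hy => ?_).trans (measure_union_le _ _)
    have hVy : Measurable fun z => V n (y, z) := (hV n).comp measurable_prodMk_left
    have e : φ n y l - c l = (((∫ z, cosInner (t l.succ) (V n (y, z)) ∂(K n y)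
          - ∫ w, cosInner (t l.succ) w ∂γ : ℝ)) : ℂ)
        + ((∫ z, sinInner (t l.succ) (V n (y, z)) ∂(K n y)
          - ∫ w, sinInner (t l.succ) w ∂γ : ℝ) : ℂ) * Complex.I := by
      simp only [hφ, hc]
      rw [hcexp, integral_exp_inner (K n y) hVy]
      push_cast
      ring
    have h2 : ε ≤ ‖φ n y l - c l‖ := hy
    rw [e] at h2
    have h3 := h2.trans (norm_add_le _ _)
    rw [norm_mul, Complex.norm_I, mul_one, Complex.norm_real, Complex.norm_real,
      Real.norm_eq_abs, Real.norm_eq_abs] at h3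
    by_contra hcon
    simp only [Set.mem_union, Set.mem_ofPred_eq, not_or, not_le] at hcon
    linarith [hcon.1, hcon.2]
  simp only [hlimit]
  -- Replace the random factors `φ` by their constant limits `c`. Constants leave the integral, so
  -- only the observed-data characteristic function remains; this is why the limits are independent
  -- although every `V n` depends on the observed data.
  have hsplit : ∀ n, charFun ((P n).map fun ω => X n (Y n ω, fun l => Z n l ω)) t
      = (∫ y, Complex.exp (⟪R n y, t 0⟫ * Complex.I) ∂(Q n)) * ∏ l, c l
        + ∫ y, Complex.exp (⟪R n y, t 0⟫ * Complex.I) * (∏ l, φ n y l - ∏ l, c l) ∂(Q n) :=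
      fun n => by
    have hexp : Integrable (fun y => Complex.exp (⟪R n y, t 0⟫ * Complex.I)) (Q n) := by
      have := hR n
      exact Integrable.of_bound (Measurable.aestronglyMeasurable (by fun_prop)) 1
        (ae_of_all _ fun p => (Complex.norm_exp_ofReal_mul_I _).le)
    have hdiff : Integrable (fun y => Complex.exp (⟪R n y, t 0⟫ * Complex.I)
        * (∏ l, φ n y l - ∏ l, c l)) (Q n) := by
      have := hR n
      have := hφmeas n
      refine Integrable.of_bound (Measurable.aestronglyMeasurable (by fun_prop))
        (∑ _l : Fin m, 2) (ae_of_all _ fun y => ?_)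
      rw [norm_mul, Complex.norm_exp_ofReal_mul_I, one_mul]
      refine (norm_prod_sub_prod_le_sum _ (hφ1 n y) hc1).trans (Finset.sum_le_sum fun l _ => ?_)
      exact (norm_sub_le _ _).trans (by linarith [hφ1 n y l, hc1 l])
    rw [hchar, ← integral_mul_const, ← integral_add (hexp.mul_const _) hdiff]
    refine integral_congr_ae (ae_of_all _ fun y => ?_)
    ring
  have hrem : Tendsto (fun n => ∫ y, Complex.exp (⟪R n y, t 0⟫ * Complex.I)
      * (∏ l, φ n y l - ∏ l, c l) ∂(Q n)) atTop (𝓝 0) := by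
    have hsum : Tendsto (fun n => ∑ l, ∫ y, ‖φ n y l - c l‖ ∂(Q n)) atTop (𝓝 0) := by
      simpa using tendsto_finsetSum Finset.univ fun l _ => hφlim l
    refine squeeze_zero_norm (fun n => ?_) hsum
    have hint : ∀ l, Integrable (fun y => ‖φ n y l - c l‖) (Q n) := fun l =>
      Integrable.of_bound ((hφmeas n l).sub_const _).norm.aestronglyMeasurable 2
        (ae_of_all _ fun y => by
          rw [norm_norm]
          exact (norm_sub_le _ _).trans (by linarith [hφ1 n y l, hc1 l]))
    rw [← integral_finsetSum _ fun l _ => hint l]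
    refine norm_integral_le_of_norm_le (integrable_finsetSum _ fun l _ => hint l)
      (ae_of_all _ fun y => ?_)
    rw [norm_mul, Complex.norm_exp_ofReal_mul_I, one_mul]
    exact norm_prod_sub_prod_le_sum _ (hφ1 n y) hc1
  have := (hRt.mul_const (∏ l, c l)).add hrem
  rw [add_zero] at this
  exact this.congr fun n => (hsplit n).symm

end JointConvergence

/-! ### Slutsky's theorem over varying probability spaces -/

section Slutsky

variable {Ω : ℕ → Type*} [∀ n, MeasurableSpace (Ω n)] {P : ∀ n, Measure (Ω n)}
  [∀ n, IsProbabilityMeasure (P n)] {Ω' : Type*} [MeasurableSpace Ω'] {P' : Measure Ω'}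
  [IsProbabilityMeasure P'] {E : Type*} [MeasurableSpace E]

/-- Convergence in distribution depends only on the laws. This allows changing the underlying
spaces, both of the sequence and of the limit. -/
lemma tendstoInDistribution_of_map_eq [TopologicalSpace E] [OpensMeasurableSpace E]
    {Ω₁ : ℕ → Type*} [∀ n, MeasurableSpace (Ω₁ n)] {P₁ : ∀ n, Measure (Ω₁ n)}
    [∀ n, IsProbabilityMeasure (P₁ n)] {Ω₂ : Type*} [MeasurableSpace Ω₂] {P₂ : Measure Ω₂}
    [IsProbabilityMeasure P₂] {X : ∀ n, Ω n → E} {X₁ : ∀ n, Ω₁ n → E} {Z : Ω' → E} {Z₂ : Ω₂ → E}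
    (hX : TendstoInDistribution X atTop Z P P') (hX₁ : ∀ n, AEMeasurable (X₁ n) (P₁ n))
    (hZ₂ : AEMeasurable Z₂ P₂) (hmap : ∀ n, (P₁ n).map (X₁ n) = (P n).map (X n))
    (hmap' : P₂.map Z₂ = P'.map Z) : TendstoInDistribution X₁ atTop Z₂ P₁ P₂ := by
  refine ⟨hX₁, hZ₂, ?_⟩
  have h := hX.tendsto
  have e1 : (fun n => (⟨(P₁ n).map (X₁ n), Measure.isProbabilityMeasure_map (hX₁ n)⟩ :
      ProbabilityMeasure E)) = fun n => ⟨(P n).map (X n),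
        Measure.isProbabilityMeasure_map (hX.forall_aemeasurable n)⟩ :=
    funext fun n => Subtype.ext (hmap n)
  have e2 : (⟨P₂.map Z₂, Measure.isProbabilityMeasure_map hZ₂⟩ : ProbabilityMeasure E)
      = ⟨P'.map Z, Measure.isProbabilityMeasure_map hX.aemeasurable_limit⟩ := Subtype.ext hmap'
  rw [e1, e2]
  exact h

/-- Convergence in distribution is not affected by a perturbation that tends to zero in probability,
also when the probability spaces vary. -/
theorem tendstoInDistribution_of_tendsto_measure_sub [NormedAddCommGroup E]
    [SecondCountableTopology E] [BorelSpace E] {X Y : ∀ n, Ω n → E} {Z : Ω' → E}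
    (hX : TendstoInDistribution X atTop Z P P') (hY : ∀ n, AEMeasurable (Y n) (P n))
    (hXY : ∀ ε : ℝ, 0 < ε → Tendsto (fun n => P n {ω | ε ≤ ‖Y n ω - X n ω‖}) atTop (𝓝 0)) :
    TendstoInDistribution Y atTop Z P P' := by
  -- All variables are lifted to one product space, where Slutsky's theorem for a fixed measure
  -- applies; the coupling across different `n` is irrelevant.
  set μ := Measure.infinitePi P with hμ
  have heval : ∀ n, MeasurePreserving (fun ω : ∀ n, Ω n => ω n) μ (P n) := fun n =>
    measurePreserving_eval_infinitePi P n
  have hmeas : ∀ {W : ∀ n, Ω n → E}, (∀ n, AEMeasurable (W n) (P n)) →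
      ∀ n, AEMeasurable (fun ω : ∀ n, Ω n => W n (ω n)) μ := fun hW n =>
    (hW n).comp_quasiMeasurePreserving (heval n).quasiMeasurePreserving
  have hmap : ∀ {W : ∀ n, Ω n → E}, (∀ n, AEMeasurable (W n) (P n)) →
      ∀ n, μ.map (fun ω : ∀ n, Ω n => W n (ω n)) = (P n).map (W n) := fun {W} hW n => by
    have h1 : AEMeasurable (W n) (μ.map fun ω : ∀ n, Ω n => ω n) := by
      rw [(heval n).map_eq]; exact hW n
    have := AEMeasurable.map_map_of_aemeasurable h1 (heval n).measurable.aemeasurable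
    rw [(heval n).map_eq] at this
    exact this.symm
  have hX' : TendstoInDistribution (fun n (ω : ∀ n, Ω n) => X n (ω n)) atTop Z (fun _ => μ) P' :=
    tendstoInDistribution_of_map_eq hX (hmeas hX.forall_aemeasurable) hX.aemeasurable_limit
      (hmap hX.forall_aemeasurable) rfl
  have hY' := tendstoInDistribution_of_tendstoInMeasure_sub
    (fun n (ω : ∀ n, Ω n) => Y n (ω n)) Z hX' (by
      rw [tendstoInMeasure_iff_norm]
      intro ε hε
      refine (hXY ε hε).congr fun n => ?_
      have hnull : NullMeasurableSet {ω | ε ≤ ‖Y n ω - X n ω‖} (P n) :=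
        nullMeasurableSet_le aemeasurable_const ((hY n).sub (hX.forall_aemeasurable n)).norm
      rw [← (heval n).measure_preimage hnull]
      simp) (hmeas hY)
  exact tendstoInDistribution_of_map_eq hY' hY hX.aemeasurable_limit
    (fun n => (hmap hY n).symm) rfl

end Slutsky

/-! ### Measurability of the statistics -/

section Measurability

variable {h k m : ℕ} {𝒴 𝒵 : ℕ → Type*} [∀ n, MeasurableSpace (𝒴 n)] [∀ n, MeasurableSpace (𝒵 n)]
  {M : SamplingModel h 𝒴 𝒵}

/-- The log-likelihood is a Carathéodory function on `Ψ`: continuous in the parameter, measurable in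
the data, hence jointly measurable. -/
lemma SamplingModel.measurable_logLik_comp (hsmooth : ∀ n x, ContDiffOn ℝ 2 (M.logLik n x) M.Ψ)
    {n : ℕ} {D : Type*} [MeasurableSpace D] {p : D → 𝒴 n × 𝒵 n} (hp : Measurable p)
    {t : D → EuclideanSpace ℝ (Fin h)} (ht : Measurable t) (htΨ : ∀ d, t d ∈ M.Ψ) :
    Measurable fun d => M.logLik n (p d) (t d) := by
  have h1 : Measurable (Function.uncurry fun (ψ : M.Ψ) (x : 𝒴 n × 𝒵 n) => M.logLik n x ψ) :=
    measurable_uncurry_of_continuous_of_measurable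
      (fun x => continuousOn_iff_continuous_domRestrict.1 (hsmooth n x).continuousOn)
      (fun ψ => Real.measurable_log.comp (M.measurable_f n ψ ψ.2))
  exact h1.comp ((Measurable.subtype_mk ht (h := htΨ)).prodMk hp)

lemma SamplingModel.dL_eq {n : ℕ} {ψ₀ ψ : EuclideanSpace ℝ (Fin h)} (hψ₀ : ψ₀ ∈ M.Ψ)
    (hψ : ψ ∈ M.Ψ) (x : 𝒴 n × 𝒵 n) :
    M.dL n ψ₀ ψ x = 2 * (M.logLik n x ψ - M.logLik n x ψ₀) := by
  rw [SamplingModel.dL, Real.log_div (M.f_pos n ψ hψ x).ne' (M.f_pos n ψ₀ hψ₀ x).ne']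
  rfl

variable {T : Estimators h m 𝒴 𝒵} {θ : EuclideanSpace ℝ (Fin h) → EuclideanSpace ℝ (Fin k)}
  {θ₀ : EuclideanSpace ℝ (Fin k)}

lemma measurable_dBar (hsmooth : ∀ n x, ContDiffOn ℝ 2 (M.logLik n x) M.Ψ)
    (hT : T.AreMLE M θ θ₀) (n : ℕ) : Measurable (dBar M T n) := by
  have hΨ : ∀ x, T.null n x ∈ M.Ψ := fun x => ((hT.null n).mem x).1
  have : dBar M T n = fun x => (1 / (m : ℝ)) * ∑ l, 2 * (M.logLik n (x l) (T.full n (x l))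
      - M.logLik n (x l) (T.null n (x l))) := by
    ext x
    simp only [dBar, SamplingModel.dL_eq (hΨ _) ((hT.full n).mem _)]
  rw [this]
  refine (Finset.measurable_sum _ fun l _ => (Measurable.sub ?_ ?_).const_mul 2).const_mul _
  · exact SamplingModel.measurable_logLik_comp hsmooth (measurable_pi_apply l)
      ((hT.full n).measurable.comp (measurable_pi_apply l)) fun x => (hT.full n).mem _
  · exact SamplingModel.measurable_logLik_comp hsmooth (measurable_pi_apply l)
      ((hT.null n).measurable.comp (measurable_pi_apply l)) fun x => hΨ _

lemma measurable_dHat (hsmooth : ∀ n x, ContDiffOn ℝ 2 (M.logLik n x) M.Ψ)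
    (hT : T.AreMLE M θ θ₀) (n : ℕ) : Measurable (dHat M T n) := by
  refine (Measurable.sub ?_ ?_).const_mul 2
  · exact (Finset.measurable_sum _ fun l _ => SamplingModel.measurable_logLik_comp hsmooth
      (measurable_pi_apply l) (hT.fullAvg n).measurable fun x => (hT.fullAvg n).mem _).const_mul _
  · exact (Finset.measurable_sum _ fun l _ => SamplingModel.measurable_logLik_comp hsmooth
      (measurable_pi_apply l) (hT.nullAvg n).measurable
      fun x => ((hT.nullAvg n).mem _).1).const_mul _

lemma measurable_comp_of_continuousOn {D E F : Type*} [MeasurableSpace D] [TopologicalSpace E]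
    [MeasurableSpace E] [BorelSpace E] [TopologicalSpace F] [MeasurableSpace F] [BorelSpace F]
    {Ψ : Set E} {g : E → F} (hg : ContinuousOn g Ψ) {t : D → E} (ht : Measurable t)
    (htΨ : ∀ d, t d ∈ Ψ) : Measurable fun d => g (t d) :=
  (continuousOn_iff_continuous_domRestrict.1 hg).measurable.comp (Measurable.subtype_mk ht (h := htΨ))

lemma SamplingModel.isProbabilityMeasure_obsLaw (n : ℕ) {ψ : EuclideanSpace ℝ (Fin h)}
    (hψ : ψ ∈ M.Ψ) : IsProbabilityMeasure (M.obsLaw n ψ) := by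
  have : IsProbabilityMeasure (M.law n ψ) := ⟨by
    rw [SamplingModel.law, withDensity_apply _ MeasurableSet.univ, Measure.restrict_univ]
    exact M.lintegral_f n ψ hψ⟩
  exact Measure.isProbabilityMeasure_map measurable_fst.aemeasurable

end Measurability

/-! ### Approximating both statistics by the standardized estimators -/

section Approximation

variable {h k m : ℕ} {𝒴 𝒵 : ℕ → Type*} [∀ n, MeasurableSpace (𝒴 n)] [∀ n, MeasurableSpace (𝒵 n)]
  {M : SamplingModel h 𝒴 𝒵} {T : Estimators h m 𝒴 𝒵}
  {θ : EuclideanSpace ℝ (Fin h) → EuclideanSpace ℝ (Fin k)} {ψs : EuclideanSpace ℝ (Fin h)}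
  {I : Matrix (Fin h) (Fin h) ℝ}

/-- The asymptotic variance of the complete-data estimator of `θ`, per observation. -/
noncomputable def unitVar (θ : EuclideanSpace ℝ (Fin h) → EuclideanSpace ℝ (Fin k))
    (ψ : EuclideanSpace ℝ (Fin h)) (I : Matrix (Fin h) (Fin h) ℝ) : Matrix (Fin k) (Fin k) ℝ :=
  jacobian θ ψ * I⁻¹ * (jacobian θ ψ).transpose

/-- The standardized complete-data estimators. -/
noncomputable def stdEst (T : Estimators h m 𝒴 𝒵)
    (θ : EuclideanSpace ℝ (Fin h) → EuclideanSpace ℝ (Fin k)) (ψs : EuclideanSpace ℝ (Fin h))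
    (I : Matrix (Fin h) (Fin h) ℝ) (n : ℕ) (x : Fin m → 𝒴 n × 𝒵 n) (l : Fin m) :
    EuclideanSpace ℝ (Fin k) :=
  √(n : ℝ) • invSqrtCLM (unitVar θ ψs I) (θ (T.full n (x l)) - θ ψs)

lemma abs_norm_sq_sub_norm_sq_le {E : Type*} [NormedAddCommGroup E] {a b : E} {η c : ℝ}
    (hab : ‖a - b‖ ≤ η) (hb : ‖b‖ ≤ c) : |‖a‖ ^ 2 - ‖b‖ ^ 2| ≤ η * (2 * c + η) := by
  have h1 : |‖a‖ - ‖b‖| ≤ η := (abs_norm_sub_norm_le a b).trans hab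
  have h2 : |‖a‖ + ‖b‖| ≤ 2 * c + η := by
    rw [abs_of_nonneg (by positivity)]
    linarith [(abs_le.1 h1).2]
  rw [sq_sub_sq, abs_mul, mul_comm]
  exact mul_le_mul h1 h2 (abs_nonneg _) ((abs_nonneg _).trans h1)

/-- `exists_lrt_approx` is applied to each data set and to the averaged likelihood, and `D w` is
then traded for the standardized estimators. The order of the quantifiers is that of the regularity
conditions: `δ` depends on `τ`, and separation is needed only at radius `ρ`. -/
theorem exists_dBar_dHat_approx (hm : 0 < m) (hψs : ψs ∈ M.Ψ) (hθ : ContDiffOn ℝ 1 θ M.Ψ)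
    (hG : Function.Surjective (fderiv ℝ θ ψs)) (hI : I.PosDef) (hT : T.AreMLE M θ (θ ψs))
    {C η : ℝ} (hC : 0 ≤ C) (hη : 0 < η) :
    ∃ τ > 0, ∀ δ > 0, ∃ ρ > 0, ∃ N : ℕ, ∀ n ≥ N, ∀ x : Fin m → 𝒴 n × 𝒵 n,
      (∀ l, GoodLik M.Ψ ψs I n C δ τ ρ (M.logLik n (x l))) →
      |dBar M T n x - meanSq (stdEst T θ ψs I n x)| ≤ η ∧
        |dHat M T n x - sqMean (stdEst T θ ψs I n x)| ≤ η := by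
  have hCpos : (unitVar θ ψs I).PosDef :=
    posDef_mul_inv_mul_transpose hI (surjective_jacobian_mulVec hG)
  obtain ⟨Pr, lam, H⟩ := infoGeometry_of_posDef hI (ofLp_fderiv_eq_jacobian_mulVec θ ψs) hCpos
  set B := invSqrtCLM (unitVar θ ψs I) with hB
  change InfoGeometry _ _ (B.comp _) B _ _ at H
  set D := B.comp (fderiv ℝ θ ψs) with hD
  have hstrict : HasStrictFDerivAt θ (fderiv ℝ θ ψs) ψs :=
    (hθ.contDiffAt (M.isOpen_Ψ.mem_nhds hψs)).hasStrictFDerivAt (by norm_num)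
  set c := ‖D‖ * (C / lam) with hc
  have hc0 : 0 ≤ c := by have := H.lam_pos; positivity
  -- Small enough to absorb both the error of the statistic and the error of squaring norms bounded
  -- by `c`.
  set η' := min 1 (η / (2 + 2 * c)) with hη'
  have hη'0 : 0 < η' := by positivity
  have hη'1 : η' ≤ 1 := min_le_left _ _
  have hη'2 : η' + η' * (2 * c + η') ≤ η := by
    have h1 : η' * (2 + 2 * c) ≤ η := by
      rw [← le_div_iff₀ (by positivity)]; exact min_le_right _ _
    have h2 : η' * η' ≤ η' * 1 := by gcongr
    linarith
  obtain ⟨τ, hτ, hmain⟩ := exists_lrt_approx H (inner_toEuclideanCLM_self_eq_sum I) M.isOpen_Ψ hψs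
    hθ.continuousOn hstrict hG hC hη'0
  refine ⟨τ, hτ, fun δ hδ => ?_⟩
  obtain ⟨ρ, hρ, N, hN⟩ := hmain δ hδ
  refine ⟨ρ, hρ, max N 1, fun n hn x hx => ?_⟩
  have hnN : N ≤ n := (le_max_left _ _).trans hn
  have hn1 : 1 ≤ n := (le_max_right _ _).trans hn
  have hs : 0 < √(n : ℝ) := Real.sqrt_pos.2 (by exact_mod_cast hn1)
  have hm' : (0 : ℝ) < m := by exact_mod_cast hm
  have hw : ∀ l, ∃ w, √(n : ℝ) • Matrix.toEuclideanCLM (𝕜 := ℝ) I w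
      = gradient (M.logLik n (x l)) ψs := fun l => by
    obtain ⟨w, hw⟩ := exists_toEuclideanCLM_eq hI ((√(n : ℝ))⁻¹ • gradient (M.logLik n (x l)) ψs)
    exact ⟨w, by rw [hw, smul_smul, mul_inv_cancel₀ hs.ne', one_smul]⟩
  choose w hw using hw
  have key := fun l => hN n hnN _ (hx l) (w l) (hw l) (T.full n (x l)) ((hT.full n).mem _)
    ((hT.full n).isMaxOn _) (T.null n (x l)) ((hT.null n).mem _) ((hT.null n).isMaxOn _)
  have havg := GoodLik.average M.isOpen_Ψ hψs hm hx
  -- The score equation is linear, so the averaged likelihood has the average of the `w l` as its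
  -- solution.
  have hwavg : √(n : ℝ) • Matrix.toEuclideanCLM (𝕜 := ℝ) I ((1 / (m : ℝ)) • ∑ l, w l)
      = gradient (fun ψ => (1 / (m : ℝ)) * ∑ l, M.logLik n (x l) ψ) ψs := by
    rw [gradient_const_mul_sum _ fun l =>
      ((hx l).smooth.contDiffAt (M.isOpen_Ψ.mem_nhds hψs)).differentiableAt (by norm_num)]
    simp only [← hw, map_smul, map_sum, smul_comm (√(n : ℝ)), Finset.smul_sum]
  have keyavg := hN n hnN _ havg _ hwavg (T.fullAvg n x) ((hT.fullAvg n).mem _)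
    ((hT.fullAvg n).isMaxOn _) (T.nullAvg n x) ((hT.nullAvg n).mem _) ((hT.nullAvg n).isMaxOn _)
  have hcard : ∀ c : ℝ, (1 / (m : ℝ)) * ∑ _l : Fin m, c = c := fun c => by
    simp only [Finset.sum_const, Finset.card_univ, Fintype.card_fin, nsmul_eq_mul]
    field_simp
  constructor
  · rw [dBar, meanSq, ← mul_sub, ← Finset.sum_sub_distrib, abs_mul, abs_of_pos (by positivity),
      ← hcard η]
    refine mul_le_mul_of_nonneg_left ((Finset.abs_sum_le_sum_abs _ _).trans
      (Finset.sum_le_sum fun l _ => ?_)) (by positivity)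
    obtain ⟨k1, k2, k3⟩ := key l
    rw [SamplingModel.dL_eq ((hT.null n).mem _).1 ((hT.full n).mem _)]
    have h1 := abs_norm_sq_sub_norm_sq_le k2 k3
    refine le_trans ?_ hη'2
    have e : 2 * (M.logLik n (x l) (T.full n (x l)) - M.logLik n (x l) (T.null n (x l)))
        - ‖stdEst T θ ψs I n x l‖ ^ 2
        = (2 * (M.logLik n (x l) (T.full n (x l)) - M.logLik n (x l) (T.null n (x l)))
          - ‖D (w l)‖ ^ 2) - (‖stdEst T θ ψs I n x l‖ ^ 2 - ‖D (w l)‖ ^ 2) := by ring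
    rw [e]
    exact (abs_sub _ _).trans (add_le_add k1 h1)
  -- The maximizer of the averaged likelihood is not compared with anything: `D` of the mean is
  -- approximated by the mean of the individual estimators.
  · obtain ⟨k1, -, k3⟩ := keyavg
    have k2 : ‖(1 / (m : ℝ)) • ∑ l, stdEst T θ ψs I n x l - D ((1 / (m : ℝ)) • ∑ l, w l)‖
        ≤ η' := by
      rw [map_smul, map_sum, ← smul_sub, ← Finset.sum_sub_distrib, norm_smul,
        Real.norm_of_nonneg (by positivity), ← hcard η']
      exact mul_le_mul_of_nonneg_left ((norm_sum_le _ _).trans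
        (Finset.sum_le_sum fun l _ => (key l).2.1)) (by positivity)
    have h1 := abs_norm_sq_sub_norm_sq_le k2 k3
    refine le_trans ?_ hη'2
    have e : dHat M T n x - sqMean (stdEst T θ ψs I n x)
        = (dHat M T n x - ‖D ((1 / (m : ℝ)) • ∑ l, w l)‖ ^ 2)
          - (‖(1 / (m : ℝ)) • ∑ l, stdEst T θ ψs I n x l‖ ^ 2
            - ‖D ((1 / (m : ℝ)) • ∑ l, w l)‖ ^ 2) := by
      rw [sqMean]; ring
    rw [e]
    exact (abs_sub _ _).trans (add_le_add k1 h1)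

theorem tendsto_measure_dBar_dHat_sub (hm : 0 < m) (hψs : ψs ∈ M.Ψ) (hθ : ContDiffOn ℝ 1 θ M.Ψ)
    (hG : Function.Surjective (fderiv ℝ θ ψs)) (hI : I.PosDef) (hT : T.AreMLE M θ (θ ψs))
    (hsmooth : ∀ n x, ContDiffOn ℝ 2 (M.logLik n x) M.Ψ)
    {Q : ∀ n, Measure (𝒴 n × 𝒵 n)} (hreg : LikelihoodRegular M ψs I Q)
    {Ω : ℕ → Type*} [∀ n, MeasurableSpace (Ω n)] {P : ∀ n, Measure (Ω n)}
    {X : ∀ n, Ω n → Fin m → 𝒴 n × 𝒵 n} (hX : ∀ n l, Measurable fun ω => X n ω l)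
    (hlaw : ∀ n l, (P n).map (fun ω => X n ω l) = Q n) {ε : ℝ} (hε : 0 < ε) :
    Tendsto (fun n => P n {ω | ε ≤ ‖(dBar M T n (X n ω), dHat M T n (X n ω))
      - (meanSq (stdEst T θ ψs I n (X n ω)), sqMean (stdEst T θ ψs I n (X n ω)))‖})
      atTop (𝓝 0) := by
  rw [ENNReal.tendsto_nhds_zero]
  intro α hα
  have hm3 : (m : ℝ≥0∞) * 3 ≠ 0 := by simp [hm.ne']
  have hm3' : (m : ℝ≥0∞) * 3 ≠ ⊤ := ENNReal.mul_ne_top (ENNReal.natCast_ne_top m) (by simp)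
  -- Three exceptional events for each of `m` data sets share the probability `α`.
  set β : ℝ≥0∞ := α / (m * 3) with hβ
  have hβ0 : 0 < β := ENNReal.div_pos hα.ne' hm3'
  obtain ⟨C, hC⟩ := hreg.score β hβ0
  obtain ⟨τ, hτ, h1⟩ := exists_dBar_dHat_approx (C := max C 0) (η := ε / 2) hm hψs hθ hG hI hT
    (le_max_right _ _) (by positivity)
  obtain ⟨δ, hδ, hinfo⟩ := hreg.info τ hτ
  obtain ⟨ρ, hρ, N, hN⟩ := h1 δ hδ
  have hsep := hreg.separated ρ hρ
  rw [ENNReal.tendsto_nhds_zero] at hinfo hsep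
  filter_upwards [hC, hinfo β hβ0, hsep β hβ0, eventually_ge_atTop N] with n g1 g2 g3 hn
  set S₁ := {x : 𝒴 n × 𝒵 n | C * √(n : ℝ) < ‖gradient (M.logLik n x) ψs‖}
  set S₂ := {x : 𝒴 n × 𝒵 n | ∃ ψ ∈ M.Ψ, ‖ψ - ψs‖ ≤ δ ∧ ∃ i j, τ < |M.info n x ψ i j - I i j|}
  set S₃ := {x : 𝒴 n × 𝒵 n | ∃ ψ ∈ M.Ψ, ρ ≤ ‖ψ - ψs‖ ∧ M.logLik n x ψs ≤ M.logLik n x ψ}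
  have hsub : {ω | ε ≤ ‖(dBar M T n (X n ω), dHat M T n (X n ω))
      - (meanSq (stdEst T θ ψs I n (X n ω)), sqMean (stdEst T θ ψs I n (X n ω)))‖}
      ⊆ ⋃ l, (fun ω => X n ω l) ⁻¹' (S₁ ∪ S₂ ∪ S₃) := by
    intro ω hω
    by_contra hcon
    simp only [Set.mem_iUnion, Set.mem_preimage, not_exists, Set.mem_union, not_or] at hcon
    have hgood : ∀ l, GoodLik M.Ψ ψs I n (max C 0) δ τ ρ (M.logLik n (X n ω l)) := fun l => by
      obtain ⟨⟨c1, c2⟩, c3⟩ := hcon l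
      refine ⟨hsmooth n _, ?_, fun ψ hψ hd i j => ?_, fun ψ hψ hd => ?_⟩
      · exact (not_lt.1 c1).trans (mul_le_mul_of_nonneg_right (le_max_left _ _)
          (Real.sqrt_nonneg _))
      · by_contra hlt
        exact c2 ⟨ψ, hψ, hd, i, j, not_le.1 hlt⟩
      · by_contra hlt
        exact c3 ⟨ψ, hψ, hd, not_lt.1 hlt⟩
    obtain ⟨a1, a2⟩ := hN n hn (X n ω) hgood
    have : ε ≤ ε / 2 := le_trans hω (by
      rw [Prod.mk_sub_mk, Prod.norm_mk]
      exact max_le a1 a2)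
    linarith
  calc P n _ ≤ P n (⋃ l, (fun ω => X n ω l) ⁻¹' (S₁ ∪ S₂ ∪ S₃)) := measure_mono hsub
    _ ≤ ∑ l : Fin m, P n ((fun ω => X n ω l) ⁻¹' (S₁ ∪ S₂ ∪ S₃)) := measure_iUnion_fintype_le _ _
    _ ≤ ∑ _l : Fin m, (β + β + β) := by
        refine Finset.sum_le_sum fun l _ => ?_
        -- The exceptional sets need not be measurable; this inequality holds for arbitrary sets.
        refine (Measure.le_map_apply (hX n l).aemeasurable _).trans ?_
        rw [hlaw]
        exact (measure_union_le _ _).trans (add_le_add ((measure_union_le _ _).trans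
          (add_le_add g1 g2)) g3)
    _ = (m * 3) * β := by
        rw [Finset.sum_const, Finset.card_univ, Fintype.card_fin, nsmul_eq_mul]
        ring
    _ = α := ENNReal.mul_div_cancel hm3 hm3'

end Approximation

/-! ### Continuous mapping and the limit law -/

section Limit

variable {h k m : ℕ} {𝒴 𝒵 : ℕ → Type*} [∀ n, MeasurableSpace (𝒴 n)] [∀ n, MeasurableSpace (𝒵 n)]

/-- `(r̂⁺ / r_m, D̂⁺)` as a function of `(d̄, d̂)`. -/
noncomputable def testStat (k m : ℕ) (rm : ℝ) (d : ℝ × ℝ) : ℝ × ℝ :=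
  (max 0 (((m : ℝ) + 1) / ((k : ℝ) * ((m : ℝ) - 1)) * (d.1 - d.2)) / rm,
    d.2 / ((k : ℝ) * (1 + max 0 (((m : ℝ) + 1) / ((k : ℝ) * ((m : ℝ) - 1)) * (d.1 - d.2)))))

/-- The positive part keeps the denominator at least `k`, so the statistic is continuous everywhere.
-/
lemma continuous_testStat (hk : 1 ≤ k) (rm : ℝ) : Continuous (testStat k m rm) := by
  have hk0 : (0 : ℝ) < k := by exact_mod_cast hk
  refine Continuous.prodMk (by fun_prop) (Continuous.div (by fun_prop) (by fun_prop) fun d => ?_)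
  have := le_max_left (0 : ℝ) (((m : ℝ) + 1) / ((k : ℝ) * ((m : ℝ) - 1)) * (d.1 - d.2))
  positivity

lemma continuous_combined (r : ℝ) (l : Fin m) :
    Continuous fun x : ImputationSpace k m => combined r x l := by
  unfold combined
  fun_prop

lemma continuous_meanSq_sqMean_combined (r : ℝ) :
    Continuous fun x : ImputationSpace k m => (meanSq (combined r x), sqMean (combined r x)) := by
  have := continuous_combined (k := k) (m := m) r
  unfold meanSq sqMean
  fun_prop

/-- Convexity of the squared norm; it makes the positive part inactive in the limit. -/
lemma sqMean_le_meanSq (hm : 0 < m) (W : Fin m → EuclideanSpace ℝ (Fin k)) :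
    sqMean W ≤ meanSq W := by
  have hm' : (0 : ℝ) < m := by exact_mod_cast hm
  have h1 : ‖∑ l, W l‖ ^ 2 ≤ m * ∑ l, ‖W l‖ ^ 2 := by
    refine (pow_le_pow_left₀ (norm_nonneg _) (norm_sum_le _ _) 2).trans ?_
    simpa using sq_sum_le_card_mul_sum_sq (s := Finset.univ) (f := fun l => ‖W l‖)
  rw [sqMean, meanSq, norm_smul, Real.norm_of_nonneg (by positivity), mul_pow]
  calc (1 / (m : ℝ)) ^ 2 * ‖∑ l, W l‖ ^ 2 ≤ (1 / (m : ℝ)) ^ 2 * (m * ∑ l, ‖W l‖ ^ 2) := by gcongr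
    _ = 1 / (m : ℝ) * ∑ l, ‖W l‖ ^ 2 := by field_simp

instance isProbabilityMeasure_chiSq (d : ℕ) : IsProbabilityMeasure (chiSq d) :=
  Measure.isProbabilityMeasure_map (Measurable.aemeasurable (by fun_prop))

/-- The law of the limit of `(r̂⁺ / r_m, D̂⁺)`, from standard normal variables. -/
theorem map_testStat_combined (hk : 1 ≤ k) (hm : 1 < m) {r rm : ℝ} (hr : 0 < r)
    (hrm : rm = (1 + 1 / (m : ℝ)) * r) {Ω' : Type*} [MeasurableSpace Ω'] {P' : Measure Ω'}
    [IsProbabilityMeasure P'] {M₁ M₂ : Ω' → ℝ} (hM₁ : HasLaw M₁ (chiSqDiv k) P')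
    (hM₂ : HasLaw M₂ (chiSqDiv (k * (m - 1))) P') (hind : IndepFun M₁ M₂ P') :
    P'.map (fun ω' => (M₂ ω', (1 + rm) * M₁ ω' / (1 + rm * M₂ ω')))
      = (stdGaussian (ImputationSpace k m)).map
        (fun x => testStat k m rm (meanSq (combined r x), sqMean (combined r x))) := by
  -- This removes the truncated subtraction in the degrees of freedom `k * (m - 1)`.
  obtain ⟨p, rfl⟩ : ∃ p, m = p + 1 := ⟨m - 1, by omega⟩
  have hp : (0 : ℝ) < p := by exact_mod_cast (by omega : 0 < p)
  have hk0 : (0 : ℝ) < k := by exact_mod_cast hk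
  have hM0 : (0 : ℝ) < ((p + 1 : ℕ) : ℝ) := by positivity
  have hrm0 : 0 < rm := by rw [hrm]; positivity
  simp only [Nat.add_sub_cancel] at hM₂
  set H : ℝ × ℝ → ℝ × ℝ := fun q => (q.2, (1 + rm) * q.1 / (1 + rm * q.2)) with hH
  set S : ℝ × ℝ → ℝ × ℝ := fun q => (q.1 / (k : ℝ), q.2 / ((k * p : ℕ) : ℝ)) with hS
  have hHm : Measurable H := by fun_prop
  have hSm : Measurable S := by fun_prop
  have hcomb := map_stdGaussian_combined (k := k) hr hrm
  have hcm : Measurable fun x : ImputationSpace k (p + 1) =>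
      (meanSq (combined r x), sqMean (combined r x)) :=
    (continuous_meanSq_sqMean_combined r).measurable
  have hcm' : Measurable fun x : ImputationSpace k (p + 1) => ((1 + rm)⁻¹ * sqMean (combined r x),
      (((p + 1 : ℕ) : ℝ) / r) * (meanSq (combined r x) - sqMean (combined r x))) :=
    (hcm.snd.const_mul _).prodMk ((hcm.fst.sub hcm.snd).const_mul _)
  have e1 : P'.map (fun ω' => (M₁ ω', M₂ ω')) = ((chiSq k).prod (chiSq (k * p))).map S := by
    rw [(indepFun_iff_map_prod_eq_prod_map_map hM₁.aemeasurable hM₂.aemeasurable).1 hind,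
      hM₁.map_eq, hM₂.map_eq, chiSqDiv, chiSqDiv, Measure.map_prod_map _ _ (by fun_prop) (by fun_prop)]
    rfl
  have e2 : P'.map (fun ω' => (M₂ ω', (1 + rm) * M₁ ω' / (1 + rm * M₂ ω')))
      = (P'.map fun ω' => (M₁ ω', M₂ ω')).map H := by
    rw [AEMeasurable.map_map_of_aemeasurable hHm.aemeasurable
      (hM₁.aemeasurable.prodMk hM₂.aemeasurable)]
    rfl
  rw [e2, e1, ← hcomb, Measure.map_map hSm hcm', Measure.map_map hHm (hSm.comp hcm')]
  congr 1
  ext1 x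
  have hle := sqMean_le_meanSq (Nat.succ_pos p) (combined r x)
  simp only [Function.comp_apply, hH, hS, testStat]
  generalize meanSq (combined r x) = a at *
  generalize sqMean (combined r x) = b at *
  -- The factor `m + 1` in the estimator turns `r / m` into `rm = (m + 1) r / m`.
  have hc : (((p + 1 : ℕ) : ℝ) + 1) / ((k : ℝ) * (((p + 1 : ℕ) : ℝ) - 1)) * (a - b)
      = rm * (((p + 1 : ℕ) : ℝ) / r * (a - b) / ((k * p : ℕ) : ℝ)) := by
    rw [hrm]
    push_cast
    have : (p : ℝ) + 1 - 1 = p := by ring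
    rw [this]
    field_simp
  have hnn : 0 ≤ (((p + 1 : ℕ) : ℝ) + 1) / ((k : ℝ) * (((p + 1 : ℕ) : ℝ) - 1)) * (a - b) := by
    rw [hc]
    have : 0 ≤ a - b := sub_nonneg.2 hle
    positivity
  rw [max_eq_right hnn, hc]
  have h1 : 0 < 1 + rm * (((p + 1 : ℕ) : ℝ) / r * (a - b) / ((k * p : ℕ) : ℝ)) := by
    rw [← hc]; positivity
  refine Prod.ext ?_ ?_
  · simp only
    field_simp
  · simp only
    rw [div_eq_div_iff h1.ne' (by positivity)]
    have : (1 + rm) * ((1 + rm)⁻¹ * b / k) * k = b := by field_simp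
    linear_combination (1 + rm * (((p + 1 : ℕ) : ℝ) / r * (a - b) / ((k * p : ℕ) : ℝ))) * this

/-- Write `θ̂ - θ* = (θ̂_obs - θ*) + (θ̂ - θ̂_obs)`. By equal fraction of missing information the
two standardizing matrices are `(1 + r) / n` and `r / n` times `unitVar`, so the identity is exact.
-/
lemma stdEst_eq_combined {T : Estimators h m 𝒴 𝒵}
    {θ : EuclideanSpace ℝ (Fin h) → EuclideanSpace ℝ (Fin k)} {ψs : EuclideanSpace ℝ (Fin h)}
    {I : Matrix (Fin h) (Fin h) ℝ} {n : ℕ} (hn : 0 < n) (hpos : (unitVar θ ψs I).PosDef) {r : ℝ}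
    (hr : 0 < r) {𝒯 : Matrix (Fin k) (Fin k) ℝ} (h𝒯 : 𝒯 = (1 + r) • Uθ θ ψs I n)
    (obs : EuclideanSpace ℝ (Fin h)) (x : Fin m → 𝒴 n × 𝒵 n) :
    stdEst T θ ψs I n x = combined r (WithLp.toLp 2 (Fin.cons (invSqrtMul 𝒯 (θ obs - θ ψs))
      fun l => invSqrtMul (𝒯 - Uθ θ ψs I n) (θ (T.full n (x l)) - θ obs)) : ImputationSpace k m) := by
  have hn' : (0 : ℝ) < n := by exact_mod_cast hn
  have hs : 0 < √(n : ℝ) := Real.sqrt_pos.2 hn'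
  have hU : Uθ θ ψs I n = (n : ℝ)⁻¹ • unitVar θ ψs I := rfl
  have hB : 𝒯 - Uθ θ ψs I n = (r / n) • unitVar θ ψs I := by
    rw [h𝒯, hU, smul_smul, ← sub_smul]
    congr 1
    field_simp
    ring
  have hT : 𝒯 = ((1 + r) / n) • unitVar θ ψs I := by
    rw [h𝒯, hU, smul_smul, div_eq_mul_inv]
  ext1 l
  have hsr : √r ≠ 0 := (Real.sqrt_pos.2 hr).ne'
  have hsr' : √(1 + r) ≠ 0 := (Real.sqrt_pos.2 (by positivity)).ne'
  simp only [combined, Fin.cons_zero, Fin.cons_succ]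
  rw [hB, hT, invSqrtMul_smul hpos (by positivity), invSqrtMul_smul hpos (by positivity),
    Real.sqrt_div (by positivity), Real.sqrt_div hr.le, inv_div, inv_div, smul_smul, smul_smul,
    mul_div_cancel₀ _ hsr, mul_div_cancel₀ _ hsr', ← smul_add, ← map_add, stdEst]
  congr 2
  abel

end Limit

end MILRT

/-! ### Assembly of the limit theorem -/

theorem mainTheorem6 {h k m : ℕ} (hk : 1 ≤ k) (hm : 1 < m)
    {𝒴 𝒵 : ℕ → Type*} [∀ n, MeasurableSpace (𝒴 n)] [∀ n, MeasurableSpace (𝒵 n)]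
    (M : MILRT.SamplingModel h 𝒴 𝒵)
    (θ : EuclideanSpace ℝ (Fin h) → EuclideanSpace ℝ (Fin k)) (θ₀ : EuclideanSpace ℝ (Fin k))
    (ψs : EuclideanSpace ℝ (Fin h))
    (K : ∀ n, Kernel (𝒴 n) (𝒵 n)) [∀ n, IsMarkovKernel (K n)]
    {Ω : ℕ → Type*} [∀ n, MeasurableSpace (Ω n)]
    (P : ∀ n, Measure (Ω n)) [∀ n, IsProbabilityMeasure (P n)]
    (Y : ∀ n, Ω n → 𝒴 n) (Z : ∀ n, Fin m → Ω n → 𝒵 n)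
    (hMI : MILRT.IsMultipleImputation M ψs K P Y Z)
    (T : MILRT.Estimators h m 𝒴 𝒵) (hT : T.AreMLE M θ θ₀)
    (obs : ∀ n, 𝒴 n → EuclideanSpace ℝ (Fin h))
    (hobs : ∀ n, MILRT.IsArgmaxEstimator M.Ψ (M.obsLik n) (obs n))
    (I : Matrix (Fin h) (Fin h) ℝ) (𝒯 : ℕ → Matrix (Fin k) (Fin k) ℝ)
    (r : ℝ) (hr : 0 < r)
    (hRC : MILRT.RCθ M θ ψs K T.full obs I 𝒯 r)
    (hH₀ : θ ψs = θ₀)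
    (rm : ℝ) (hrm : rm = (1 + 1 / (m : ℝ)) * r)
    {Ω' : Type*} [MeasurableSpace Ω'] (P' : Measure Ω') [IsProbabilityMeasure P']
    (M₁ M₂ : Ω' → ℝ) (hM₁ : HasLaw M₁ (MILRT.chiSqDiv k) P')
    (hM₂ : HasLaw M₂ (MILRT.chiSqDiv (k * (m - 1))) P') (hind : IndepFun M₁ M₂ P') :
    TendstoInDistribution
      (fun n ω => (MILRT.rHatPlus k M T n (MILRT.completed Y Z n ω) / rm,
        MILRT.DHatPlus k M T n (MILRT.completed Y Z n ω)))
      atTop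
      (fun ω' => (M₂ ω', (1 + rm) * M₁ ω' / (1 + rm * M₂ ω')))
      P P' := by
  open MILRT in
  subst hH₀
  have hm0 : 0 < m := by omega
  have hprob : ∀ n, IsProbabilityMeasure (M.obsLaw n ψs) := fun n =>
    M.isProbabilityMeasure_obsLaw n hRC.mem_Ψ
  have hpos : (unitVar θ ψs I).PosDef :=
    posDef_mul_inv_mul_transpose hRC.posDef_I (surjective_jacobian_mulVec hRC.full_rank)
  have hcompl : ∀ n, Measurable (completed Y Z n) := fun n => measurable_pi_iff.2 fun l =>
    (hMI.measurable_obs n).prodMk (hMI.measurable_mis n l)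
  have hθfull : ∀ n, Measurable fun x => θ (T.full n x) := fun n =>
    measurable_comp_of_continuousOn hRC.smooth_θ.continuousOn (hT.full n).measurable (hT.full n).mem
  have hθobs : ∀ n, Measurable fun y => θ (obs n y) := fun n =>
    measurable_comp_of_continuousOn hRC.smooth_θ.continuousOn (hobs n).measurable (hobs n).mem
  have hinv : ∀ A : Matrix (Fin k) (Fin k) ℝ, Measurable (invSqrtMul A) := fun A =>
    (invSqrtCLM A).continuous.measurable
  have hjoint := tendstoInDistribution_imputations (Q := fun n => M.obsLaw n ψs) (K := K)
    (R := fun n y => invSqrtMul (𝒯 n) (θ (obs n y) - θ ψs))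
    (V := fun n x => invSqrtMul (𝒯 n - Uθ θ ψs I n) (θ (T.full n x) - θ (obs n x.1)))
    hMI.measurable_obs hMI.measurable_mis hMI.cond_indep
    (fun n => (hinv _).comp ((hθobs n).sub_const _))
    (fun n => (hinv _).comp ((hθfull n).sub ((hθobs n).comp measurable_fst)))
    hRC.obs_normal hRC.proper
  have hd := tendstoInDistribution_of_tendsto_measure_sub
    (hjoint.continuous_comp (continuous_meanSq_sqMean_combined r))
    (Y := fun n ω => (dBar M T n (completed Y Z n ω), dHat M T n (completed Y Z n ω)))
    (fun n => (((measurable_dBar hRC.smooth_logLik hT n).comp (hcompl n)).prodMk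
      ((measurable_dHat hRC.smooth_logLik hT n).comp (hcompl n))).aemeasurable) (fun ε hε => by
    refine (tendsto_measure_dBar_dHat_sub hm0 hRC.mem_Ψ hRC.smooth_θ hRC.full_rank hRC.posDef_I hT
      hRC.smooth_logLik hRC.regular_completed (X := completed Y Z)
      (fun n l => (measurable_pi_apply l).comp (hcompl n))
      (fun n l => map_prodMk_eq_compProd (hMI.measurable_obs n) (hMI.measurable_mis n)
        (hMI.cond_indep n) l) hε).congr' ?_
    -- The decomposition of the estimators divides by `n`, so the events are identified only for `n
    -- > 0`.
    filter_upwards [eventually_gt_atTop 0] with n hn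
    congr 1
    ext ω
    have := stdEst_eq_combined (T := T) hn hpos hr (hRC.efmi n) (obs n (Y n ω))
      (completed Y Z n ω)
    rw [Set.mem_ofPred_eq, Set.mem_ofPred_eq, this]
    rfl)
  have hstat := hd.continuous_comp (continuous_testStat (m := m) hk rm)
  -- The limit is carried from the Gaussian space to the given variables `M₁`, `M₂` by equality of
  -- laws.
  refine tendstoInDistribution_of_map_eq hstat hstat.forall_aemeasurable ?_ (fun n => rfl)
    (map_testStat_combined hk hm hr hrm hM₁ hM₂ hind)
  have h1 := hM₁.aemeasurable
  have h2 := hM₂.aemeasurable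
  fun_prop
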